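/- Let $k$ be a field. For a Hopf algebra $H$ over $k$ (not necessarily finite dimensional), with comultiplication $\Delta(h)=h_1\otimes h_2$, counit $\varepsilon$ and antipode $S$, let $\int_l^{H^*}$ be the space of left integrals for $H$, i.e. of all $\lambda\in H^*$ with $p(h_1)\lambda(h_2)=p(1)\lambda(h)$ for all $p\in H^*$ and $h\in H$; $H$ is co-Frobenius if $\int_l^{H^*}\neq 0$. For $H$ co-Frobenius, the modular element $a_H\in H$ is the grouplike element with $\lambda(h_1)h_2=\lambda(h)a_H^{-1}$ for all $\lambda\in\int_l^{H^*}$, $h\in H$; the generalized Nakayama automorphism $\chi_H$ is the algebra automorphism of $H$ with $\lambda(mh)=\lambda(\chi_H(h)m)$ for all $\lambda\in\int_l^{H^*}$, $h,m\in H$; and the modular element of $H$ in $H^*$ is the algebra map $\alpha_H=\varepsilon\circ\chi_H:H\to k$. A quasitriangular Hopf algebra is a pair $(H,R)$ with $R=R^1\otimes R^2=r^1\otimes r^2\in H\otimes H$ invertible such that $\Delta^{\rm cop}(h)R=R\Delta(h)$ for all $h\in H$, $\Delta(R^1)\otimes R^2=R^1\otimes r^1\otimes R^2r^2$, $R^1\otimes\Delta(R^2)=R^1r^1\otimes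 r^2\otimes R^2$, and $\varepsilon(R^1)R^2=1=\varepsilon(R^2)R^1$. **Corollary.** Let $(H,R)$ be a co-Frobenius quasitriangular Hopf algebra, and let $L\subseteq H$ be its minimal quasitriangular sub-Hopf algebra, that is, a sub-Hopf algebra with $R\in L\otimes L$ such that no proper sub-Hopf algebra $K$ of $L$ satisfies $R\in K\otimes K$. Then $L$ is co-Frobenius, the elements $a_H,a_L$ and the automorphisms $\chi_H,\chi_L$ exist and are unique, and the following are equivalent: 1. $a_L=a_H$; 2. $\alpha_L=\alpha_H|_L$; 3. $\chi_L=\chi_H|_L$, i.e. $\chi_L(x)=\chi_H(x)$ for all $x\in L$. -/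

import Mathlib

open scoped TensorProduct

noncomputable section

/-- A sub-Hopf algebra of the Hopf algebra `H`: a subalgebra `L` with `Δ(L) ⊆ L ⊗ L`
(the image of `L ⊗ L` in `H ⊗ H`) and `S(L) ⊆ L`. -/
structure SubHopfAlgebra (k : Type*) (H : Type*) [Field k] [Ring H] [HopfAlgebra k H]
    extends Subalgebra k H where
  comul_mem' : ∀ x ∈ toSubalgebra, CoalgebraStruct.comul (R := k) x ∈
    (Algebra.TensorProduct.map toSubalgebra.val toSubalgebra.val).range
  antipode_mem' : ∀ x ∈ toSubalgebra, HopfAlgebraStruct.antipode k x ∈ toSubalgebra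

namespace SubHopfAlgebra

variable {k : Type*} {H : Type*} [Field k] [Ring H] [HopfAlgebra k H] (L : SubHopfAlgebra k H)

/-- The canonical map `L ⊗ L → H ⊗ H`. -/
def inclTensor : L.toSubalgebra ⊗[k] L.toSubalgebra →ₐ[k] H ⊗[k] H :=
  Algebra.TensorProduct.map L.toSubalgebra.val L.toSubalgebra.val

theorem inclTensor_injective : Function.Injective L.inclTensor :=
  TensorProduct.map_injective_of_flat_flat L.toSubalgebra.val.toLinearMap
    L.toSubalgebra.val.toLinearMap Subtype.val_injective Subtype.val_injective

/-- The comultiplication of `H` corestricted to `L → L ⊗ L`. -/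
def comulHom : L.toSubalgebra →ₐ[k] L.toSubalgebra ⊗[k] L.toSubalgebra :=
  (AlgEquiv.ofInjective L.inclTensor L.inclTensor_injective).symm.toAlgHom.comp
    (((Bialgebra.comulAlgHom k H).comp L.toSubalgebra.val).codRestrict L.inclTensor.range
      (fun x => L.comul_mem' x x.2))

theorem inclTensor_comulHom (x : L.toSubalgebra) :
    L.inclTensor (L.comulHom x) = CoalgebraStruct.comul (R := k) (x : H) := by
  have h := AlgEquiv.apply_symm_apply
    (AlgEquiv.ofInjective L.inclTensor L.inclTensor_injective)
    ((((Bialgebra.comulAlgHom k H).comp L.toSubalgebra.val).codRestrict L.inclTensor.range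
      (fun x => L.comul_mem' x x.2)) x)
  exact congrArg Subtype.val h

theorem inclTensor_comp_comulHom :
    TensorProduct.map L.toSubalgebra.val.toLinearMap L.toSubalgebra.val.toLinearMap ∘ₗ
      L.comulHom.toLinearMap =
    (CoalgebraStruct.comul (R := k) (A := H)) ∘ₗ L.toSubalgebra.val.toLinearMap :=
  LinearMap.ext L.inclTensor_comulHom

theorem coassoc_aux :
    (TensorProduct.assoc k L.toSubalgebra L.toSubalgebra L.toSubalgebra).toLinearMap ∘ₗ
      LinearMap.rTensor L.toSubalgebra L.comulHom.toLinearMap ∘ₗ L.comulHom.toLinearMap =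
    LinearMap.lTensor L.toSubalgebra L.comulHom.toLinearMap ∘ₗ L.comulHom.toLinearMap := by
  set i := L.toSubalgebra.val.toLinearMap with hi
  set D := L.comulHom.toLinearMap with hD
  have hc : TensorProduct.map i i ∘ₗ D = (CoalgebraStruct.comul (R := k) (A := H)) ∘ₗ i :=
    L.inclTensor_comp_comulHom
  have hinj : Function.Injective (TensorProduct.map i (TensorProduct.map i i)) :=
    TensorProduct.map_injective_of_flat_flat i (TensorProduct.map i i)
      Subtype.val_injective L.inclTensor_injective
  have h1 : TensorProduct.map i (TensorProduct.map i i) ∘ₗ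
      (TensorProduct.assoc k L.toSubalgebra L.toSubalgebra L.toSubalgebra).toLinearMap =
      (TensorProduct.assoc k H H H).toLinearMap ∘ₗ
        TensorProduct.map (TensorProduct.map i i) i := by
    ext; simp
  have h2 : TensorProduct.map (TensorProduct.map i i) i ∘ₗ LinearMap.rTensor L.toSubalgebra D =
      LinearMap.rTensor H (CoalgebraStruct.comul (R := k) (A := H)) ∘ₗ TensorProduct.map i i := by
    rw [LinearMap.map_comp_rTensor, hc, LinearMap.rTensor_comp_map]
  have h3 : TensorProduct.map i (TensorProduct.map i i) ∘ₗ LinearMap.lTensor L.toSubalgebra D =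
      LinearMap.lTensor H (CoalgebraStruct.comul (R := k) (A := H)) ∘ₗ TensorProduct.map i i := by
    rw [LinearMap.map_comp_lTensor, hc, LinearMap.lTensor_comp_map]
  have key : TensorProduct.map i (TensorProduct.map i i) ∘ₗ
      ((TensorProduct.assoc k L.toSubalgebra L.toSubalgebra L.toSubalgebra).toLinearMap ∘ₗ
        LinearMap.rTensor L.toSubalgebra D ∘ₗ D) =
      TensorProduct.map i (TensorProduct.map i i) ∘ₗ
        (LinearMap.lTensor L.toSubalgebra D ∘ₗ D) := by
    refine LinearMap.ext fun x => ?_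
    have e0 := LinearMap.congr_fun hc x
    have e1 := LinearMap.congr_fun h1 (LinearMap.rTensor L.toSubalgebra D (D x))
    have e2 := LinearMap.congr_fun h2 (D x)
    have e3 := LinearMap.congr_fun h3 (D x)
    have e4 := LinearMap.congr_fun (Coalgebra.coassoc (R := k) (A := H)) (i x)
    simp only [LinearMap.comp_apply] at e0 e1 e2 e3 e4 ⊢
    rw [e1, e2, e3, e0, e4]
  exact LinearMap.ext fun x => hinj (LinearMap.congr_fun key x)

theorem rTensor_counit_aux (x : L.toSubalgebra) :
    LinearMap.rTensor L.toSubalgebra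
      ((CoalgebraStruct.counit (R := k) (A := H)) ∘ₗ L.toSubalgebra.val.toLinearMap)
      (L.comulHom x) = 1 ⊗ₜ[k] x := by
  set i := L.toSubalgebra.val.toLinearMap with hi
  have hinj : Function.Injective (LinearMap.lTensor k i) :=
    Module.Flat.lTensor_preserves_injective_linearMap i Subtype.val_injective
  apply hinj
  rw [← LinearMap.comp_apply, LinearMap.lTensor_comp_rTensor,
    ← LinearMap.id_comp i, ← LinearMap.comp_assoc, ← LinearMap.rTensor_comp_map,
    LinearMap.comp_apply]
  have h := L.inclTensor_comulHom x
  change TensorProduct.map i i (L.comulHom x) = _ at h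
  rw [LinearMap.comp_id, LinearMap.id_comp, h, Coalgebra.rTensor_counit_comul]
  rfl

theorem lTensor_counit_aux (x : L.toSubalgebra) :
    LinearMap.lTensor L.toSubalgebra
      ((CoalgebraStruct.counit (R := k) (A := H)) ∘ₗ L.toSubalgebra.val.toLinearMap)
      (L.comulHom x) = x ⊗ₜ[k] 1 := by
  set i := L.toSubalgebra.val.toLinearMap with hi
  have hinj : Function.Injective (LinearMap.rTensor k i) :=
    Module.Flat.rTensor_preserves_injective_linearMap i Subtype.val_injective
  apply hinj
  rw [← LinearMap.comp_apply, LinearMap.rTensor_comp_lTensor,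
    ← LinearMap.id_comp i, ← LinearMap.comp_assoc, ← LinearMap.lTensor_comp_map,
    LinearMap.comp_apply]
  have h := L.inclTensor_comulHom x
  change TensorProduct.map i i (L.comulHom x) = _ at h
  rw [LinearMap.comp_id, LinearMap.id_comp, h, Coalgebra.lTensor_counit_comul]
  rfl

/-- The bialgebra structure inherited from `H`. -/
instance instBialgebra : Bialgebra k L.toSubalgebra :=
  Bialgebra.ofAlgHom L.comulHom ((Bialgebra.counitAlgHom k H).comp L.toSubalgebra.val)
    (AlgHom.ext fun x => LinearMap.congr_fun L.coassoc_aux x)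
    (AlgHom.ext fun x => L.rTensor_counit_aux x)
    (AlgHom.ext fun x => L.lTensor_counit_aux x)

/-- The antipode of `H` restricted to `L → L`. -/
def antipodeHom : L.toSubalgebra →ₗ[k] L.toSubalgebra :=
  ((HopfAlgebraStruct.antipode k : H →ₗ[k] H).comp
    L.toSubalgebra.val.toLinearMap).codRestrict (Subalgebra.toSubmodule L.toSubalgebra)
      (fun x => L.antipode_mem' x x.2)

theorem val_mul' : L.toSubalgebra.val.toLinearMap ∘ₗ LinearMap.mul' k L.toSubalgebra =
    LinearMap.mul' k H ∘ₗ
      TensorProduct.map L.toSubalgebra.val.toLinearMap L.toSubalgebra.val.toLinearMap := by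
  ext; simp

theorem val_antipodeHom : L.toSubalgebra.val.toLinearMap ∘ₗ L.antipodeHom =
    (HopfAlgebraStruct.antipode k : H →ₗ[k] H) ∘ₗ L.toSubalgebra.val.toLinearMap := rfl

/-- The Hopf algebra structure inherited from `H`. -/
instance instHopfAlgebra : HopfAlgebra k L.toSubalgebra where
  antipode := L.antipodeHom
  mul_antipode_rTensor_comul := by
    refine LinearMap.ext fun x => Subtype.val_injective ?_
    have h := L.inclTensor_comulHom x
    have h1 := LinearMap.congr_fun L.val_mul'
      (LinearMap.rTensor L.toSubalgebra L.antipodeHom (L.comulHom x))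
    rw [LinearMap.comp_apply, LinearMap.comp_apply, ← LinearMap.comp_apply (TensorProduct.map _ _),
      LinearMap.map_comp_rTensor, val_antipodeHom, ← LinearMap.rTensor_comp_map,
      LinearMap.comp_apply] at h1
    refine h1.trans ((congrArg (fun z => LinearMap.mul' k H (LinearMap.rTensor H _ z)) h).trans ?_)
    exact HopfAlgebra.mul_antipode_rTensor_comul_apply (x : H)
  mul_antipode_lTensor_comul := by
    refine LinearMap.ext fun x => Subtype.val_injective ?_
    have h := L.inclTensor_comulHom x
    have h1 := LinearMap.congr_fun L.val_mul'
      (LinearMap.lTensor L.toSubalgebra L.antipodeHom (L.comulHom x))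
    rw [LinearMap.comp_apply, LinearMap.comp_apply, ← LinearMap.comp_apply (TensorProduct.map _ _),
      LinearMap.map_comp_lTensor, val_antipodeHom, ← LinearMap.lTensor_comp_map,
      LinearMap.comp_apply] at h1
    refine h1.trans ((congrArg (fun z => LinearMap.mul' k H (LinearMap.lTensor H _ z)) h).trans ?_)
    exact HopfAlgebra.mul_antipode_lTensor_comul_apply (x : H)

end SubHopfAlgebra

section Integrals

variable (k : Type*) (H : Type*) [Field k] [Ring H] [HopfAlgebra k H]

/-- The space of left integrals for `H` in `H^*`: the functionals `l` with `p * l = p(1) l` for the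
convolution product and every `p ∈ H^*`, i.e. `p(h₁) l(h₂) = p(1) l(h)`. -/
def leftIntegrals : Submodule k (Module.Dual k H) where
  carrier := {l | ∀ p : Module.Dual k H,
    LinearMap.mul' k k ∘ₗ TensorProduct.map p l ∘ₗ CoalgebraStruct.comul = p 1 • l}
  add_mem' := by
    intro a b ha hb p
    rw [TensorProduct.map_add_right, LinearMap.add_comp, LinearMap.comp_add, ha p, hb p, smul_add]
  zero_mem' := by
    intro p
    rw [TensorProduct.map_zero_right, LinearMap.zero_comp, LinearMap.comp_zero, smul_zero]
  smul_mem' := by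
    intro c a ha p
    rw [TensorProduct.map_smul_right, LinearMap.smul_comp, LinearMap.comp_smul, ha p, smul_comm]

/-- `H` is co-Frobenius: it has a nonzero left integral in `H^*`. -/
def IsCoFrobenius : Prop := leftIntegrals k H ≠ ⊥

variable {k H}

/-- `a` is the modular (distinguished grouplike) element of `H` in `H`:
`l(h₁) h₂ = l(h) a⁻¹` for every left integral `l`. -/
def IsModularElement (a : GroupLike k H) : Prop :=
  ∀ l ∈ leftIntegrals k H, ∀ h : H,
    TensorProduct.lid k H (LinearMap.rTensor H l (CoalgebraStruct.comul h)) = l h • (a⁻¹).val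

/-- `χ` is the generalized Nakayama (Frobenius) automorphism of `H`: for every left integral `l`,
`h ⇀ l = l ↼ χ(h)`, i.e. `l(m h) = l(χ(h) m)` for all `m`. -/
def IsNakayama (χ : H ≃ₐ[k] H) : Prop :=
  ∀ l ∈ leftIntegrals k H, ∀ h m : H, l (m * h) = l (χ h * m)

/-- The modular element `α = ε ∘ χ` of `H` in `H^*`, for `χ` the generalized Nakayama
automorphism. -/
def modularFunctional (χ : H ≃ₐ[k] H) : H →ₐ[k] k :=
  (Bialgebra.counitAlgHom k H).comp χ.toAlgHom

end Integrals

section Quasitriangular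

variable {k : Type*} {H : Type*} [Field k] [Ring H] [HopfAlgebra k H]

/-- `R₁₂ = R¹ ⊗ R² ⊗ 1`. -/
def leg12 (R : H ⊗[k] H) : H ⊗[k] (H ⊗[k] H) :=
  Algebra.TensorProduct.map (AlgHom.id k H) Algebra.TensorProduct.includeLeft R

/-- `R₁₃ = R¹ ⊗ 1 ⊗ R²`. -/
def leg13 (R : H ⊗[k] H) : H ⊗[k] (H ⊗[k] H) :=
  Algebra.TensorProduct.map (AlgHom.id k H) Algebra.TensorProduct.includeRight R

/-- `R₂₃ = 1 ⊗ R¹ ⊗ R²`. -/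
def leg23 (R : H ⊗[k] H) : H ⊗[k] (H ⊗[k] H) :=
  (1 : H) ⊗ₜ[k] R

/-- `(H, R)` is a quasitriangular Hopf algebra. -/
structure IsQuasitriangular (R : H ⊗[k] H) : Prop where
  isUnit : IsUnit R
  /-- `Δ^cop(h) R = R Δ(h)`. -/
  comul_cop : ∀ h : H, TensorProduct.comm k H H (CoalgebraStruct.comul h) * R
    = R * CoalgebraStruct.comul h
  /-- `Δ(R¹) ⊗ R² = R¹ ⊗ r¹ ⊗ R² r²`. -/
  comul_left : TensorProduct.assoc k H H H (LinearMap.rTensor H CoalgebraStruct.comul R)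
    = leg13 R * leg23 R
  /-- `R¹ ⊗ Δ(R²) = R¹ r¹ ⊗ r² ⊗ R²`. -/
  comul_right : LinearMap.lTensor H CoalgebraStruct.comul R = leg13 R * leg12 R
  /-- `ε(R¹) R² = 1`. -/
  counit_left : TensorProduct.lid k H (LinearMap.rTensor H CoalgebraStruct.counit R) = 1
  /-- `ε(R²) R¹ = 1`. -/
  counit_right : TensorProduct.rid k H (LinearMap.lTensor H CoalgebraStruct.counit R) = 1

/-- `L` is the minimal quasitriangular sub-Hopf algebra of `(H, R)`: `R ∈ L ⊗ L`, and `L` has no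
proper sub-Hopf algebra `K` with `R ∈ K ⊗ K`. -/
def IsMinimalQuasitriangular (R : H ⊗[k] H) (L : SubHopfAlgebra k H) : Prop :=
  R ∈ L.inclTensor.range ∧
    ∀ K : SubHopfAlgebra k H, R ∈ K.inclTensor.range →
      K.toSubalgebra ≤ L.toSubalgebra → K.toSubalgebra = L.toSubalgebra

end Quasitriangular

end

/-! The theorem rests on one formula. Write `u = S(R²)R¹` for the Drinfeld element. Applying `id ⊗
λ`, for a nonzero left integral `λ`, to `RΔ(h) = Δ^cop(h)R` and using the hexagon identity for `R¹ ⊗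
Δ(R²)` gives `R¹S(R²) = a⁻¹ u R¹α(R²)` (`IsQuasitriangular.mulAntipode_eq`). This holds in `H` and
in `L`, with the same `R` and `u`, so `a_L⁻¹ u R¹α_L(R²) = a_H⁻¹ u R¹α_H(R²)`.

Since `u` is invertible, and so is the slice of `R` by a character, equal characters force equal
modular elements. If the modular elements agree, then `α_L` and `α_H` have the same slice on the
second leg of `R`. The same argument for the structure `R₂₁⁻¹` handles the first leg. By minimality
`L` is generated by the slices of `R`, so a character of `L` is determined by these two slices.
Finally `S²(χ(h)) = h₁α(h₂)`, so `χ` and `α = ε∘χ` determine each other.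

Existence and uniqueness need a bijective antipode, which holds because `u` implements `S²` as
conjugation. The tool for integrals is the exchange rule `y₁λ(cy₂) = S(c₁)λ(c₂y)`. It gives
nondegeneracy, uniqueness of integrals up to a scalar, and the modular element. The Nakayama
automorphism and the co-Frobenius property of `L` come from `exists_sum_integral_mulLeft`, an
instance of the structure theorem for Hopf modules: a functional generating a finite-dimensional
submodule of the dual is a sum of translates of integrals. -/

open scoped TensorProduct

noncomputable section

open Coalgebra HopfAlgebra WithConv

/-! ### Slices of tensors by functionals -/

section Slices

variable {k V W : Type*} [Field k] [AddCommGroup V] [Module k V] [AddCommGroup W] [Module k W]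

/-- The slice `(id ⊗ p) t`. -/
def sliceRight (p : Module.Dual k W) : V ⊗[k] W →ₗ[k] V :=
  (TensorProduct.rid k V).toLinearMap ∘ₗ LinearMap.lTensor V p

/-- The slice `(p ⊗ id) t`. -/
def sliceLeft (p : Module.Dual k V) : V ⊗[k] W →ₗ[k] W :=
  (TensorProduct.lid k W).toLinearMap ∘ₗ LinearMap.rTensor W p

@[simp] theorem sliceRight_tmul (p : Module.Dual k W) (v : V) (w : W) :
    sliceRight p (v ⊗ₜ[k] w) = p w • v := by simp [sliceRight]

@[simp] theorem sliceLeft_tmul (p : Module.Dual k V) (v : V) (w : W) :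
    sliceLeft p (v ⊗ₜ[k] w) = p v • w := by simp [sliceLeft]

/-- A tensor whose left slices lie in `N` is killed by every bilinear map killing `V × N`. -/
theorem lift_eq_zero_of_sliceLeft_mem {M : Type*} [AddCommGroup M] [Module k M]
    (N : Submodule k W) (f : V ⊗[k] W →ₗ[k] M) (hf : ∀ v, ∀ w ∈ N, f (v ⊗ₜ w) = 0)
    (t : V ⊗[k] W) (ht : ∀ p : Module.Dual k V, sliceLeft p t ∈ N) : f t = 0 := by
  let b := Module.Basis.ofVectorSpace k V
  obtain ⟨c, rfl⟩ := TensorProduct.eq_repr_basis_left b t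
  -- The coefficients of `t` in a basis of `V` are its slices along the coordinate functionals.
  have hc : ∀ i, c i ∈ N := by
    intro i
    have h := ht (b.coord i)
    rw [Finsupp.sum, map_sum] at h
    simp only [sliceLeft_tmul, Module.Basis.coord_apply, Module.Basis.repr_self] at h
    by_cases hi : i ∈ c.support
    · rw [Finset.sum_eq_single i] at h
      · simpa using h
      · intro j _ hj
        rw [Finsupp.single_eq_of_ne hj.symm, zero_smul]
      · intro h'; exact absurd hi h'
    · rw [Finsupp.notMem_support_iff.mp hi]; exact N.zero_mem
  rw [Finsupp.sum, map_sum]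
  exact Finset.sum_eq_zero fun i _ => hf _ _ (hc i)

theorem eq_zero_of_sliceLeft_eq_zero (t : V ⊗[k] W)
    (ht : ∀ p : Module.Dual k V, sliceLeft p t = 0) : t = 0 :=
  lift_eq_zero_of_sliceLeft_mem (⊥ : Submodule k W) LinearMap.id
    (fun v w hw => by rw [(Submodule.mem_bot k).mp hw]; simp) t (fun p => by simp [ht p])

theorem sliceLeft_comm (p : Module.Dual k W) (t : V ⊗[k] W) :
    sliceLeft p (TensorProduct.comm k V W t) = sliceRight p t := by
  induction t with
  | zero => simp
  | tmul x y => simp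
  | add x y hx hy => simp only [map_add, hx, hy]

theorem apply_sliceLeft (p : Module.Dual k V) (q : Module.Dual k W) (t : V ⊗[k] W) :
    q (sliceLeft p t) = p (sliceRight q t) := by
  induction t with
  | zero => simp
  | tmul x y => simp [mul_comm]
  | add x y hx hy => simp only [map_add, hx, hy]

theorem eq_zero_of_sliceRight_eq_zero (t : V ⊗[k] W)
    (ht : ∀ p : Module.Dual k W, sliceRight p t = 0) : t = 0 := by
  apply (TensorProduct.comm k V W).injective
  rw [map_zero]
  exact eq_zero_of_sliceLeft_eq_zero _ fun p => by rw [sliceLeft_comm, ht p]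

end Slices

/-! ### The action of the dual algebra on a coalgebra -/

section Hit

variable {k C : Type*} [Field k] [AddCommGroup C] [Module k C] [Coalgebra k C]

/-- The endomorphism `x ↦ x₁ p(x₂)` of a coalgebra. -/
def hit (p : Module.Dual k C) : C →ₗ[k] C := sliceRight p ∘ₗ comul

theorem hit_repr (p : Module.Dual k C) {x : C} {ι : Type*} (r : Repr k x ι) :
    hit p x = ∑ i ∈ r.index, p (r.right i) • r.left i := by
  simp [hit, ← r.eq]

theorem comul_hit (p : Module.Dual k C) (x : C) :
    comul (R := k) (hit p x) = LinearMap.lTensor C (hit p) (comul x) := by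
  have h := Coalgebra.coassoc_apply (R := k) x
  have e : ∀ t : C ⊗[k] C, LinearMap.lTensor C (sliceRight p)
      (TensorProduct.assoc k C C C (LinearMap.rTensor C comul t)) = comul (sliceRight p t) := by
    intro t
    induction t with
    | zero => simp
    | tmul a b =>
      simp only [LinearMap.rTensor_tmul, sliceRight_tmul, map_smul]
      generalize (comul a : C ⊗[k] C) = s
      induction s with
      | zero => simp
      | tmul a b => simp [sliceRight, TensorProduct.tmul_smul]
      | add x y hx hy => simp only [map_add, TensorProduct.add_tmul, smul_add, hx, hy]
    | add x y hx hy => simp only [map_add, hx, hy]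
  rw [hit, LinearMap.comp_apply, ← e, h, ← LinearMap.comp_apply (LinearMap.lTensor C _),
    ← LinearMap.lTensor_comp]

/-- `p ∘ₗ hit q` is the convolution product of `p` and `q`. Hence the range of `(hit ρ).dualMap`,
used below, is the left ideal generated by `ρ` in the dual. -/
theorem hit_comp_hit (p q : Module.Dual k C) : hit p ∘ₗ hit q = hit (p ∘ₗ hit q) := by
  ext x
  have e : ∀ (f : C →ₗ[k] C) (t : C ⊗[k] C),
      sliceRight p (LinearMap.lTensor C f t) = sliceRight (p ∘ₗ f) t := by
    intro f t
    induction t with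
    | zero => simp
    | tmul a b => simp
    | add x y hx hy => simp only [map_add, hx, hy]
  rw [LinearMap.comp_apply, hit, LinearMap.comp_apply, comul_hit, e]
  rfl

theorem hit_counit : hit (counit (R := k) (A := C)) = LinearMap.id := by
  ext x
  simp [hit, sliceRight]

theorem counit_hit (p : Module.Dual k C) (x : C) : counit (R := k) (hit p x) = p x := by
  rw [hit_repr p (ℛ k x), map_sum]
  conv_rhs => rw [← sum_counit_smul (ℛ k x), map_sum]
  simp [mul_comm]

end Hit

/-! ### Convolution identities for the antipode -/

section Antipode

variable {k H : Type*} [Field k] [Ring H] [HopfAlgebra k H]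

theorem algHom_convMul_comp_antipode {A : Type*} [Ring A] [Algebra k A] (f : H →ₐ[k] A) :
    toConv f.toLinearMap * toConv (f.toLinearMap ∘ₗ antipode k) = 1 := by
  ext x
  rw [(ℛ k x).convMul_apply]
  simp [← map_mul, ← map_sum, sum_mul_antipode_eq_algebraMap_counit (ℛ k x)]

theorem comp_antipode_convMul_algHom {A : Type*} [Ring A] [Algebra k A] (f : H →ₐ[k] A) :
    toConv (f.toLinearMap ∘ₗ antipode k) * toConv f.toLinearMap = 1 := by
  ext x
  rw [(ℛ k x).convMul_apply]
  simp [← map_mul, ← map_sum, sum_antipode_mul_eq_algebraMap_counit (ℛ k x)]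

/-- Both sides are convolution inverses of `Δ`. For the right side, `Δ` is the convolution product
of the two inclusions `i₁`, `i₂`, whose inverses are `i₁∘S` and `i₂∘S`. -/
theorem comul_antipode (x : H) : comul (R := k) (antipode k x) =
    TensorProduct.map (antipode k) (antipode k) (TensorProduct.comm k H H (comul x)) := by
  let i₁ : H →ₐ[k] H ⊗[k] H := Algebra.TensorProduct.includeLeft
  let i₂ : H →ₐ[k] H ⊗[k] H := Algebra.TensorProduct.includeRight
  have hΔ : toConv (Bialgebra.comulAlgHom k H).toLinearMap =
      toConv i₁.toLinearMap * toConv i₂.toLinearMap := by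
    ext x
    rw [(ℛ k x).convMul_apply]
    simp [i₁, i₂, (ℛ k x).eq]
  have hG : toConv (i₂.toLinearMap ∘ₗ antipode k) * toConv (i₁.toLinearMap ∘ₗ antipode k) =
      toConv (TensorProduct.map (antipode k) (antipode k) ∘ₗ
        (TensorProduct.comm k H H).toLinearMap ∘ₗ comul) := by
    ext x
    rw [(ℛ k x).convMul_apply]
    simp [i₁, i₂, ← (ℛ k x).eq]
  have h1 : toConv (TensorProduct.map (antipode k) (antipode k) ∘ₗ
        (TensorProduct.comm k H H).toLinearMap ∘ₗ comul) *
        toConv (Bialgebra.comulAlgHom k H).toLinearMap = 1 := by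
    rw [← hG, hΔ, mul_assoc, ← mul_assoc (toConv (i₁.toLinearMap ∘ₗ antipode k)),
      comp_antipode_convMul_algHom, one_mul, comp_antipode_convMul_algHom]
  have h2 := left_inv_eq_right_inv h1 (algHom_convMul_comp_antipode (Bialgebra.comulAlgHom k H))
  exact (LinearMap.congr_fun (congrArg ofConv h2) x).symm

/-- `y₁ ν(c y₂) = S(c₁) (c₂ y)₁ ν((c₂ y)₂)`. -/
theorem hit_comp_mulLeft (ν : Module.Dual k H) (y : H) {c : H} {ι : Type*} (r : Repr k c ι) :
    hit (ν ∘ₗ LinearMap.mulLeft k c) y =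
      ∑ i ∈ r.index, antipode k (r.left i) * hit ν (r.right i * y) := by
  obtain ⟨F, hF⟩ : ∃ F : H →ₗ[k] H, ∀ c, F c = hit (ν ∘ₗ LinearMap.mulLeft k c) y :=
    ⟨{  toFun := fun c => hit (ν ∘ₗ LinearMap.mulLeft k c) y
        map_add' := fun a b => by
          simp only [hit_repr _ (ℛ k y), LinearMap.comp_apply, LinearMap.mulLeft_apply, add_mul,
            map_add, add_smul, Finset.sum_add_distrib]
        map_smul' := fun a b => by
          simp only [hit_repr _ (ℛ k y), LinearMap.comp_apply, LinearMap.mulLeft_apply,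
            smul_mul_assoc, map_smul, smul_assoc, Finset.smul_sum, RingHom.id_apply] },
      fun _ => rfl⟩
  obtain ⟨G, hG⟩ : ∃ G : H →ₗ[k] H, ∀ c, G c = hit ν (c * y) :=
    ⟨hit ν ∘ₗ LinearMap.mulRight k y, fun _ => rfl⟩
  -- As functions of `c`, the two sides of `Δ(cy) = Δ(c)Δ(y)` give `id * F = G`; convolving with `S`
  -- isolates `F`.
  have h : toConv LinearMap.id * toConv F = toConv G := by
    ext c
    rw [(ℛ k c).convMul_apply]
    simp only [LinearMap.id_apply, hF, hG]
    rw [hit_repr ν ((ℛ k c).mul (ℛ k y))]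
    simp [hit_repr _ (ℛ k y), Finset.sum_product, Finset.mul_sum]
  have h' : toConv F = toConv (antipode k) * toConv G := by
    rw [← h, ← mul_assoc, LinearMap.antipode_mul_id, one_mul]
  have h2 := congrArg (fun f : WithConv (H →ₗ[k] H) => f c) h'
  simp only [r.convMul_apply, hF, hG] at h2
  exact h2

/-- The endomorphism `x ↦ p(x₁) x₂`. -/
def hitLeft (p : Module.Dual k H) : H →ₗ[k] H := sliceLeft p ∘ₗ comul

theorem hitLeft_repr (p : Module.Dual k H) {x : H} {ι : Type*} (r : Repr k x ι) :
    hitLeft p x = ∑ i ∈ r.index, p (r.left i) • r.right i := by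
  simp [hitLeft, ← r.eq]

/-- `ν(h₁ c) h₂ = ν((h c₁)₁) (h c₁)₂ S(c₂)`. -/
theorem hitLeft_comp_mulRight (ν : Module.Dual k H) (h : H) {c : H} {ι : Type*} (r : Repr k c ι) :
    hitLeft (ν ∘ₗ LinearMap.mulRight k c) h =
      ∑ i ∈ r.index, hitLeft ν (h * r.left i) * antipode k (r.right i) := by
  obtain ⟨F, hF⟩ : ∃ F : H →ₗ[k] H, ∀ c, F c = hitLeft (ν ∘ₗ LinearMap.mulRight k c) h :=
    ⟨{  toFun := fun c => hitLeft (ν ∘ₗ LinearMap.mulRight k c) h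
        map_add' := fun a b => by
          simp only [hitLeft_repr _ (ℛ k h), LinearMap.comp_apply, LinearMap.mulRight_apply,
            mul_add, map_add, add_smul, Finset.sum_add_distrib]
        map_smul' := fun a b => by
          simp only [hitLeft_repr _ (ℛ k h), LinearMap.comp_apply, LinearMap.mulRight_apply,
            mul_smul_comm, map_smul, smul_assoc, Finset.smul_sum, RingHom.id_apply] },
      fun _ => rfl⟩
  obtain ⟨G, hG⟩ : ∃ G : H →ₗ[k] H, ∀ c, G c = hitLeft ν (h * c) :=
    ⟨hitLeft ν ∘ₗ LinearMap.mulLeft k h, fun _ => rfl⟩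
  have e : toConv F * toConv LinearMap.id = toConv G := by
    ext c
    rw [(ℛ k c).convMul_apply]
    simp only [LinearMap.id_apply, hF, hG]
    rw [hitLeft_repr ν ((ℛ k h).mul (ℛ k c))]
    simp only [hitLeft_repr _ (ℛ k h), Repr.mul_index, Finset.sum_product_right, Finset.sum_mul]
    simp
  have e' : toConv F = toConv G * toConv (antipode k) := by
    rw [← e, mul_assoc, LinearMap.id_mul_antipode, mul_one]
  have h2 := congrArg (fun f : WithConv (H →ₗ[k] H) => f c) e'
  simp only [r.convMul_apply, hF, hG] at h2
  exact h2

end Antipode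

/-! ### The inverse antipode -/

section BijectiveAntipode

variable {k H : Type*} [Field k] [Ring H] [HopfAlgebra k H]

/-- The inverse of a bijective antipode. -/
def antipodeInv (hS : Function.Bijective (antipode k : H →ₗ[k] H)) : H →ₗ[k] H :=
  (LinearEquiv.ofBijective (antipode k : H →ₗ[k] H) hS).symm.toLinearMap

variable (hS : Function.Bijective (antipode k : H →ₗ[k] H))

@[simp] theorem antipode_antipodeInv (x : H) : antipode k (antipodeInv hS x) = x :=
  (LinearEquiv.ofBijective (antipode k : H →ₗ[k] H) hS).apply_symm_apply x

@[simp] theorem antipodeInv_antipode (x : H) : antipodeInv hS (antipode k x) = x :=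
  (LinearEquiv.ofBijective (antipode k : H →ₗ[k] H) hS).symm_apply_apply x

theorem antipodeInv_mul (x y : H) :
    antipodeInv hS (x * y) = antipodeInv hS y * antipodeInv hS x :=
  hS.1 (by simp [antipode_mul_antidistrib])

@[simp] theorem antipodeInv_one : antipodeInv hS 1 = 1 := hS.1 (by simp)

theorem comul_antipodeInv (x : H) : comul (R := k) (antipodeInv hS x) =
    TensorProduct.map (antipodeInv hS) (antipodeInv hS)
      (TensorProduct.comm k H H (comul x)) := by
  have h := comul_antipode (k := k) (antipodeInv hS x)
  rw [antipode_antipodeInv] at h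
  have e : ∀ t : H ⊗[k] H, TensorProduct.map (antipodeInv hS) (antipodeInv hS)
      (TensorProduct.comm k H H (TensorProduct.map (antipode k) (antipode k)
        (TensorProduct.comm k H H t))) = t := by
    intro t
    induction t with
    | zero => simp
    | tmul a b => simp
    | add x y hx hy => simp only [map_add, hx, hy]
  rw [h, e]

theorem sum_mul_antipodeInv {c : H} {ι : Type*} (r : Repr k c ι) :
    ∑ i ∈ r.index, r.right i * antipodeInv hS (r.left i) = counit (R := k) c • (1 : H) := by
  apply hS.1
  simp [antipode_mul_antidistrib, sum_mul_antipode_eq_smul r]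

end BijectiveAntipode

/-! ### Nondegeneracy and uniqueness of integrals, the modular element -/

section Integrals

variable {k H : Type*} [Field k] [Ring H] [HopfAlgebra k H]

theorem counit_hitLeft (p : Module.Dual k H) (x : H) :
    counit (R := k) (hitLeft p x) = p x := by
  rw [hitLeft_repr p (ℛ k x), map_sum]
  conv_rhs => rw [← LinearMap.id_apply (R := k) x, ← hit_counit, hit_repr _ (ℛ k x), map_sum]
  simp [mul_comm]

theorem apply_hit (p q : Module.Dual k H) (x : H) : p (hit q x) = q (hitLeft p x) :=
  (apply_sliceLeft p q _).symm

/-- Functionals separate the points of `H`, so the arbitrary `p` in the definition can be stripped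
off. -/
theorem mem_leftIntegrals_iff {l : Module.Dual k H} :
    l ∈ leftIntegrals k H ↔ ∀ x, hit l x = l x • (1 : H) := by
  have e : ∀ (p : Module.Dual k H) (t : H ⊗[k] H),
      LinearMap.mul' k k (TensorProduct.map p l t) = p (sliceRight l t) := by
    intro p t
    induction t with
    | zero => simp
    | tmul a b => simp [mul_comm]
    | add x y hx hy => simp only [map_add, hx, hy]
  constructor
  · intro h x
    rw [← sub_eq_zero, ← Module.forall_dual_apply_eq_zero_iff k]
    intro p
    have := LinearMap.congr_fun (h p) x
    simp only [LinearMap.comp_apply, e, LinearMap.smul_apply, smul_eq_mul] at this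
    rw [map_sub, map_smul, smul_eq_mul, mul_comm, sub_eq_zero]
    exact this
  · intro h p
    ext x
    simp only [LinearMap.comp_apply, e, LinearMap.smul_apply, smul_eq_mul]
    change p (hit l x) = _
    rw [h x, map_smul, smul_eq_mul, mul_comm]

/-- The exchange rule: in `hit_comp_mulLeft` the inner `hit` collapses to a scalar because `l` is an
integral. -/
theorem hit_integral_comp_mulLeft {l : Module.Dual k H} (hl : l ∈ leftIntegrals k H) (y : H)
    {c : H} {ι : Type*} (r : Repr k c ι) :
    hit (l ∘ₗ LinearMap.mulLeft k c) y =
      ∑ i ∈ r.index, l (r.right i * y) • antipode k (r.left i) := by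
  simp [hit_comp_mulLeft l y r, mem_leftIntegrals_iff.mp hl]

variable {l : Module.Dual k H}

/-- Left nondegeneracy of a nonzero left integral. -/
theorem eq_zero_of_integral_mul_eq_zero (hS : Function.Bijective (antipode k : H →ₗ[k] H))
    (hl : l ∈ leftIntegrals k H) (hl0 : l ≠ 0) {h : H} (hh : ∀ x, l (h * x) = 0) : h = 0 := by
  let N : Submodule k H := LinearMap.ker ((LinearMap.mul k H).compr₂ l)
  have hN : ∀ {h : H}, h ∈ N ↔ ∀ x, l (h * x) = 0 := by
    intro h
    rw [LinearMap.mem_ker, LinearMap.ext_iff]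
    rfl
  -- Testing the exchange rule against `q ∘ S⁻¹` cancels the antipode and leaves `q(h₁) l(h₂x)`.
  have hA : ∀ {h : H}, h ∈ N → ∀ q : Module.Dual k H, hitLeft q h ∈ N := by
    intro h hh q
    rw [hN] at hh ⊢
    intro x
    have h1 : l ∘ₗ LinearMap.mulLeft k h = 0 := LinearMap.ext hh
    have h2 := congrArg (q ∘ₗ antipodeInv hS) (hit_integral_comp_mulLeft hl x (ℛ k h))
    rw [h1, map_sum] at h2
    simp only [LinearMap.comp_apply, map_smul, antipodeInv_antipode] at h2
    rw [hitLeft_repr q (ℛ k h), Finset.sum_mul, map_sum]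
    simp only [smul_mul_assoc, map_smul, smul_eq_mul] at h2 ⊢
    simp_rw [mul_comm (q _)]
    rw [← h2]
    simp [hit, sliceRight]
  -- Write `ε(h) l(x) = l(h₂S⁻¹(h₁)x)`: by `hA` the factor `h₂` may be taken in `N`. Then `q(h) =
  -- ε(q(h₁)h₂) = 0` for every `q`.
  have hB : ∀ {h : H}, h ∈ N → counit (R := k) h = 0 := by
    intro h hh
    obtain ⟨x, hx⟩ : ∃ x, l x ≠ 0 := by
      by_contra! hc
      exact hl0 (LinearMap.ext hc)
    let f : H ⊗[k] H →ₗ[k] k := l ∘ₗ LinearMap.mulRight k x ∘ₗ LinearMap.mul' k H ∘ₗ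
      (TensorProduct.comm k H H).toLinearMap ∘ₗ LinearMap.rTensor H (antipodeInv hS)
    have h1 : f (comul h) = 0 := by
      refine lift_eq_zero_of_sliceLeft_mem N f ?_ _ (hA hh)
      intro v w hw
      simpa [f, mul_assoc] using hN.mp hw (antipodeInv hS v * x)
    have h2 : f (comul h) = counit (R := k) h * l x := by
      have h3 := congrArg (fun z => l (z * x)) (sum_mul_antipodeInv hS (ℛ k h))
      simp only [smul_mul_assoc, one_mul, map_smul, smul_eq_mul] at h3
      rw [← h3, ← (ℛ k h).eq]
      simp [f, Finset.sum_mul]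
    rw [h1] at h2
    exact (mul_eq_zero.mp h2.symm).resolve_right hx
  rw [← Module.forall_dual_apply_eq_zero_iff k]
  intro q
  rw [← counit_hitLeft q h]
  exact hB (hA (hN.mpr hh) q)

theorem eq_of_integral_mul_eq (hS : Function.Bijective (antipode k : H →ₗ[k] H))
    (hl : l ∈ leftIntegrals k H) (hl0 : l ≠ 0) {h h' : H} (hh : ∀ x, l (h * x) = l (h' * x)) :
    h = h' := by
  rw [← sub_eq_zero]
  exact eq_zero_of_integral_mul_eq_zero hS hl hl0 fun x => by
    rw [sub_mul, map_sub, hh, sub_self]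

theorem tensor_eq_of_integral_mul_eq (hS : Function.Bijective (antipode k : H →ₗ[k] H))
    (hl : l ∈ leftIntegrals k H) (hl0 : l ≠ 0) {V : Type*} [AddCommGroup V] [Module k V]
    {s t : V ⊗[k] H} (h : ∀ y, sliceRight (l ∘ₗ LinearMap.mulRight k y) s =
      sliceRight (l ∘ₗ LinearMap.mulRight k y) t) : s = t := by
  rw [← sub_eq_zero]
  refine eq_zero_of_sliceLeft_eq_zero _ fun p => ?_
  refine eq_zero_of_integral_mul_eq_zero hS hl hl0 fun y => ?_
  have := apply_sliceLeft p (l ∘ₗ LinearMap.mulRight k y) (s - t)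
  rw [map_sub (sliceRight _), h, sub_self, map_zero] at this
  exact this

/-- Right nondegeneracy of a nonzero left integral. -/
theorem eq_zero_of_mul_integral_eq_zero (hl : l ∈ leftIntegrals k H) (hl0 : l ≠ 0) {h : H}
    (hh : ∀ x, l (x * h) = 0) : h = 0 := by
  let N : Submodule k H := LinearMap.ker ((LinearMap.mul k H).flip.compr₂ l)
  have hN : ∀ {h : H}, h ∈ N ↔ ∀ x, l (x * h) = 0 := by
    intro h
    rw [LinearMap.mem_ker, LinearMap.ext_iff]
    rfl
  -- Here `q(h₁) l(xh₂)` is already one side of the exchange rule, so no inverse antipode is needed.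
  have hA : ∀ {h : H}, h ∈ N → ∀ q : Module.Dual k H, hitLeft q h ∈ N := by
    intro h hh q
    rw [hN] at hh ⊢
    intro x
    have h1 := apply_hit q (l ∘ₗ LinearMap.mulLeft k x) h
    rw [hit_integral_comp_mulLeft hl h (ℛ k x)] at h1
    simpa [hh] using h1.symm
  have hB : ∀ {h : H}, h ∈ N → counit (R := k) h = 0 := by
    intro h hh
    obtain ⟨x, hx⟩ : ∃ x, l x ≠ 0 := by
      by_contra! hc
      exact hl0 (LinearMap.ext hc)
    let f : H ⊗[k] H →ₗ[k] k := l ∘ₗ LinearMap.mulLeft k x ∘ₗ LinearMap.mul' k H ∘ₗ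
      LinearMap.rTensor H (antipode k)
    have h1 : f (comul h) = 0 := by
      refine lift_eq_zero_of_sliceLeft_mem N f ?_ _ (hA hh)
      intro v w hw
      simpa [f, mul_assoc] using hN.mp hw (x * antipode k v)
    have h2 : f (comul h) = counit (R := k) h * l x := by
      simp [f, Algebra.algebraMap_eq_smul_one]
    rw [h1] at h2
    exact (mul_eq_zero.mp h2.symm).resolve_right hx
  rw [← Module.forall_dual_apply_eq_zero_iff k]
  intro q
  rw [← counit_hitLeft q h]
  exact hB (hA (hN.mpr hh) q)

/-- The antipode reverses `Δ`, so it turns the left integral `l` into a right integral `l ∘ S`. -/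
theorem hitLeft_integral_comp_antipode (hS : Function.Bijective (antipode k : H →ₗ[k] H))
    (hl : l ∈ leftIntegrals k H) (h : H) :
    hitLeft (l ∘ₗ antipode k) h = l (antipode k h) • (1 : H) := by
  apply hS.1
  have e : ∀ t : H ⊗[k] H, antipode k (sliceLeft (l ∘ₗ antipode k) t) =
      sliceRight l (TensorProduct.map (antipode k) (antipode k)
        (TensorProduct.comm k H H t)) := by
    intro t
    induction t with
    | zero => simp
    | tmul a b => simp
    | add x y hx hy => simp only [map_add, hx, hy]
  rw [hitLeft, LinearMap.comp_apply, e, ← comul_antipode, map_smul, antipode_one]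
  exact mem_leftIntegrals_iff.mp hl _

/-- The exchange rule for `l` gives `m(x₁) l(hx₂) = m(S(h₁)) l(h₂x)`, and `m ∘ S` is a right
integral. By nondegeneracy `hitLeft m x` then depends on `x` only through `l x`, which yields both
uniqueness of integrals and the modular element. -/
theorem integral_mul_hitLeft (hS : Function.Bijective (antipode k : H →ₗ[k] H))
    (hl : l ∈ leftIntegrals k H) {m : Module.Dual k H} (hm : m ∈ leftIntegrals k H) (h x : H) :
    l (h * hitLeft m x) = m (antipode k h) * l x := by
  have h1 := apply_hit m (l ∘ₗ LinearMap.mulLeft k h) x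
  rw [hit_integral_comp_mulLeft hl x (ℛ k h), map_sum] at h1
  have h2 := congrArg (fun z => l (z * x)) (hitLeft_integral_comp_antipode hS hm h)
  rw [hitLeft_repr _ (ℛ k h)] at h2
  simp only [Finset.sum_mul, map_sum, smul_mul_assoc, map_smul, one_mul, smul_eq_mul,
    LinearMap.comp_apply] at h1 h2
  rw [← h2]
  refine h1.symm.trans (Finset.sum_congr rfl fun i _ => mul_comm _ _)

theorem hitLeft_eq_zero_of_integral_eq_zero
    (hS : Function.Bijective (antipode k : H →ₗ[k] H)) (hl : l ∈ leftIntegrals k H) (hl0 : l ≠ 0)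
    {m : Module.Dual k H} (hm : m ∈ leftIntegrals k H) {x : H} (hx : l x = 0) :
    hitLeft m x = 0 :=
  eq_zero_of_mul_integral_eq_zero hl hl0 fun h => by
    rw [integral_mul_hitLeft hS hl hm, hx, mul_zero]

theorem exists_integral_eq_one (hl0 : l ≠ 0) : ∃ x, l x = 1 := by
  obtain ⟨x, hx⟩ : ∃ x, l x ≠ 0 := by
    by_contra! hc
    exact hl0 (LinearMap.ext hc)
  exact ⟨(l x)⁻¹ • x, by simp [hx]⟩

theorem hitLeft_integral_eq_smul (hS : Function.Bijective (antipode k : H →ₗ[k] H))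
    (hl : l ∈ leftIntegrals k H) (hl0 : l ≠ 0) {m : Module.Dual k H}
    (hm : m ∈ leftIntegrals k H) {x₀ : H} (hx₀ : l x₀ = 1) (x : H) :
    hitLeft m x = l x • hitLeft m x₀ := by
  rw [← sub_eq_zero, ← map_smul, ← map_sub]
  exact hitLeft_eq_zero_of_integral_eq_zero hS hl hl0 hm (by simp [hx₀])

/-- Uniqueness of left integrals up to a scalar. -/
theorem exists_eq_smul_integral (hS : Function.Bijective (antipode k : H →ₗ[k] H))
    (hl : l ∈ leftIntegrals k H) (hl0 : l ≠ 0) {m : Module.Dual k H}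
    (hm : m ∈ leftIntegrals k H) : ∃ c : k, m = c • l := by
  obtain ⟨x₀, hx₀⟩ := exists_integral_eq_one hl0
  refine ⟨m x₀, LinearMap.ext fun x => ?_⟩
  have := congrArg (counit (R := k)) (hitLeft_integral_eq_smul hS hl hl0 hm hx₀ x)
  rw [map_smul, counit_hitLeft, counit_hitLeft, smul_eq_mul, mul_comm] at this
  exact this

theorem comul_hitLeft (p : Module.Dual k H) (x : H) :
    comul (R := k) (hitLeft p x) = LinearMap.rTensor H (hitLeft p) (comul x) := by
  have h := Coalgebra.coassoc_symm_apply (R := k) x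
  have e : ∀ t : H ⊗[k] H, LinearMap.rTensor H (sliceLeft p)
      ((TensorProduct.assoc k H H H).symm (LinearMap.lTensor H comul t)) =
        comul (sliceLeft p t) := by
    intro t
    induction t with
    | zero => simp
    | tmul a b =>
      simp only [LinearMap.lTensor_tmul, sliceLeft_tmul, map_smul]
      generalize (comul b : H ⊗[k] H) = s
      induction s with
      | zero => simp
      | tmul a b => simp [sliceLeft, TensorProduct.smul_tmul']
      | add x y hx hy => simp only [map_add, TensorProduct.tmul_add, smul_add, hx, hy]
    | add x y hx hy => simp only [map_add, hx, hy]
  rw [hitLeft, LinearMap.comp_apply, ← e, h, ← LinearMap.comp_apply (LinearMap.rTensor H _),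
    ← LinearMap.rTensor_comp]

/-- All values of `hitLeft l` are multiples of the single element `hitLeft l x₀`, and
coassociativity makes this element grouplike. -/
theorem exists_isModularElement (hS : Function.Bijective (antipode k : H →ₗ[k] H))
    (hl : l ∈ leftIntegrals k H) (hl0 : l ≠ 0) : ∃ a : GroupLike k H, IsModularElement a := by
  obtain ⟨x₀, hx₀⟩ := exists_integral_eq_one hl0
  have key := hitLeft_integral_eq_smul hS hl hl0 hl hx₀
  have hg : IsGroupLikeElem k (hitLeft l x₀) := by
    constructor
    · rw [counit_hitLeft, hx₀]
    · have e : ∀ t : H ⊗[k] H, LinearMap.rTensor H (hitLeft l) t =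
          hitLeft l x₀ ⊗ₜ[k] sliceLeft l t := by
        intro t
        induction t with
        | zero => simp
        | tmul a b => simp [key a, TensorProduct.smul_tmul]
        | add x y hx hy => simp only [map_add, TensorProduct.tmul_add, hx, hy]
      rw [comul_hitLeft, e]
      rfl
  refine ⟨(⟨hitLeft l x₀, hg⟩ : GroupLike k H)⁻¹, fun m hm h => ?_⟩
  obtain ⟨c, rfl⟩ := exists_eq_smul_integral hS hl hl0 hm
  rw [inv_inv]
  have e : TensorProduct.lid k H (LinearMap.rTensor H (c • l) (comul h)) = c • hitLeft l h := by
    simp [hitLeft, sliceLeft, LinearMap.rTensor_smul]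
  rw [e, key h, LinearMap.smul_apply, smul_assoc]

theorem IsModularElement.hitLeft_eq {a : GroupLike k H} (ha : IsModularElement a)
    (hl : l ∈ leftIntegrals k H) (h : H) : hitLeft l h = l h • (a⁻¹).val :=
  ha l hl h

theorem existsUnique_isModularElement (hS : Function.Bijective (antipode k : H →ₗ[k] H))
    (hl : l ∈ leftIntegrals k H) (hl0 : l ≠ 0) : ∃! a : GroupLike k H, IsModularElement a := by
  obtain ⟨a, ha⟩ := exists_isModularElement hS hl hl0
  refine ⟨a, ha, fun b hb => ?_⟩
  obtain ⟨x, hx⟩ := exists_integral_eq_one hl0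
  have h1 := (hb.hitLeft_eq hl x).symm.trans (ha.hitLeft_eq hl x)
  rw [hx, one_smul, one_smul] at h1
  exact inv_injective (GroupLike.val_injective h1)

end Integrals

/-- Independence of the `f i` says that the dual of the map `V → kⁿ` they define is injective, hence
that this map is onto; the `x i` lift the standard basis. -/
theorem exists_dual_family {k V : Type*} [Field k] [AddCommGroup V] [Module k V] {n : ℕ}
    (f : Fin n → Module.Dual k V) (hf : LinearIndependent k f) :
    ∃ x : Fin n → V, ∀ i j, f j (x i) = if i = j then 1 else 0 := by
  have hinj : Function.Injective (LinearMap.pi f : V →ₗ[k] Fin n → k).dualMap := by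
    rw [← LinearMap.ker_eq_bot, LinearMap.ker_eq_bot']
    intro φ hφ
    have h1 : ∑ i, φ (Pi.single i 1) • f i = 0 := by
      ext v
      have h2 := LinearMap.congr_fun hφ v
      have h4 : ∀ i : Fin n, (Pi.single i 1 : Fin n → k) = fun j => if i = j then 1 else 0 :=
        fun i => funext fun j => by simp [Pi.single_apply, eq_comm]
      rw [LinearMap.dualMap_apply, LinearMap.pi_apply_eq_sum_univ φ] at h2
      simpa [mul_comm, h4] using h2
    have h3 := Fintype.linearIndependent_iff.mp hf _ h1
    ext i
    simpa using h3 i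
  have hsurj := LinearMap.dualMap_injective_iff.mp hinj
  choose x hx using fun i : Fin n => hsurj (Pi.single i 1)
  refine ⟨x, fun i j => ?_⟩
  have := congrFun (hx i) j
  simpa [Pi.single_apply, eq_comm] using this

theorem Submodule.exists_linearIndependent_family {k D : Type*} [Field k] [AddCommGroup D]
    [Module k D] (V : Submodule k D) [FiniteDimensional k V] :
    ∃ (n : ℕ) (r : Fin n → D), (∀ j, r j ∈ V) ∧ LinearIndependent k r ∧
      ∀ v ∈ V, ∃ a : Fin n → k, v = ∑ i, a i • r i := by
  let B := Module.finBasis k V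
  refine ⟨_, fun j => B j, fun j => (B j).2,
    B.linearIndependent.map' V.subtype (Submodule.ker_subtype V), fun v hv =>
      ⟨B.repr ⟨v, hv⟩, ?_⟩⟩
  have := congrArg V.subtype (B.sum_repr ⟨v, hv⟩)
  rw [map_sum] at this
  exact this.symm

theorem exists_biorthogonal_family {k W : Type*} [Field k] [AddCommGroup W] [Module k W]
    (V : Submodule k (Module.Dual k W)) [FiniteDimensional k V] :
    ∃ (n : ℕ) (r : Fin n → Module.Dual k W) (x : Fin n → W), (∀ j, r j ∈ V) ∧
      (∀ i j, r j (x i) = if i = j then 1 else 0) ∧ ∀ v ∈ V, ∀ y, v y = ∑ i, v (x i) * r i y := by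
  obtain ⟨n, r, hr, hli, hexp⟩ := V.exists_linearIndependent_family
  obtain ⟨x, hx⟩ := exists_dual_family r hli
  refine ⟨n, r, x, hr, hx, fun v hv y => ?_⟩
  obtain ⟨a, rfl⟩ := hexp v hv
  simp [hx]

/-! ### Finite-dimensional submodules of the dual and translates of integrals -/

section IntegralTranslates

variable {k H : Type*} [Field k] [Ring H] [HopfAlgebra k H]

/-- A functional generating a finite-dimensional left submodule of `H^*` is a combination of
translates of left integrals. -/
theorem exists_sum_integral_mulLeft (hS : Function.Bijective (antipode k : H →ₗ[k] H))
    (ρ : Module.Dual k H) [FiniteDimensional k (LinearMap.range (hit ρ).dualMap)] :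
    ∃ (n : ℕ) (m : Fin n → Module.Dual k H) (b : Fin n → H),
      (∀ j, m j ∈ leftIntegrals k H) ∧ ∀ x, ρ x = ∑ j, m j (b j * x) := by
  set V : Submodule k (Module.Dual k H) := LinearMap.range (hit ρ).dualMap
  obtain ⟨n, r, x, hr, hx, hexp⟩ := exists_biorthogonal_family V
  have hstab : ∀ v ∈ V, ∀ q : Module.Dual k H, q ∘ₗ hit v ∈ V := by
    rintro v ⟨p, rfl⟩ q
    refine ⟨q ∘ₗ hit p, ?_⟩
    change (q ∘ₗ hit p) ∘ₗ hit ρ = q ∘ₗ hit (p ∘ₗ hit ρ)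
    rw [← hit_comp_hit, LinearMap.comp_assoc]
  have hρ : ρ ∈ V := ⟨counit, LinearMap.ext fun y => counit_hit ρ y⟩
  -- The matrix coefficients of the comodule `V` in the basis `r`: `Δ(c i j) = ∑ c i m ⊗ c m j` and
  -- `ε(c i j) = δ`.
  obtain ⟨c, hc⟩ : ∃ c : Fin n → Fin n → H, ∀ i j, c i j = hit (r j) (x i) := ⟨_, fun _ _ => rfl⟩
  have hhit : ∀ j y, hit (r j) y = ∑ i, r i y • c i j := by
    intro j y
    rw [← sub_eq_zero, ← Module.forall_dual_apply_eq_zero_iff k]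
    intro q
    have := hexp _ (hstab (r j) (hr j) q) y
    rw [map_sub, sub_eq_zero, map_sum]
    simpa [hc, mul_comm] using this
  have hcounit : ∀ i j, counit (R := k) (c i j) = if i = j then 1 else 0 := by
    intro i j
    rw [hc, counit_hit, hx]
  have hcomul : ∀ i j, ∑ m, c i m ⊗ₜ[k] c m j = comul (R := k) (c i j) := by
    intro i j
    have e : ∀ t : H ⊗[k] H, LinearMap.lTensor H (hit (r j)) t =
        ∑ m, sliceRight (r m) t ⊗ₜ[k] c m j := by
      intro t
      induction t with
      | zero => simp
      | tmul a b => simp [hhit, TensorProduct.tmul_sum, TensorProduct.smul_tmul]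
      | add x y hx hy =>
        simp only [map_add, TensorProduct.add_tmul, Finset.sum_add_distrib, hx, hy]
    rw [hc i j, comul_hit, e]
    simp only [hc i]
    rfl
  let T := antipodeInv hS
  have hcomul' : ∀ i j, ∑ m, T (T (c i m)) ⊗ₜ[k] T (T (c m j)) =
      comul (R := k) (T (T (c i j))) := by
    intro i j
    simp [T, comul_antipodeInv, ← hcomul i j]
  let rc : ∀ i j, Repr k (c i j) (Fin n) := fun i j =>
    { index := Finset.univ, left := c i, right := fun m => c m j, eq := hcomul i j }
  let rd : ∀ i j, Repr k (T (T (c i j))) (Fin n) := fun i j =>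
    { index := Finset.univ, left := fun m => T (T (c i m)), right := fun m => T (T (c m j)),
      eq := hcomul' i j }
  have hinv : ∀ l m, ∑ i, T (c i l) * c m i = if m = l then 1 else 0 := by
    intro l m
    have := congrArg T (sum_antipode_mul_eq_smul (rc m l))
    simpa [rc, T, antipodeInv_mul, hcounit, apply_ite] using this
  have hinv' : ∀ i l, ∑ j, T (T (c i j)) * T (c j l) = if i = l then 1 else 0 := by
    intro i l
    have := congrArg T (sum_mul_antipodeInv hS (rc i l))
    simpa [rc, T, antipodeInv_mul, hcounit, apply_ite] using this
  -- The projection onto coinvariants of a Hopf module. `T²` is chosen because `hit_comp_mulLeft`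
  -- applies `S` once, leaving `T(c i l)`, which cancels against the `c m i` coming from `hit (r i)`
  -- by `hinv`.
  let Λ : Fin n → Module.Dual k H := fun j => ∑ i, r i ∘ₗ LinearMap.mulLeft k (T (T (c i j)))
  refine ⟨n, Λ, fun j => ∑ l, ρ (x l) • T (c j l), fun j => ?_, fun y => ?_⟩
  · rw [mem_leftIntegrals_iff]
    intro y
    have h1 : hit (Λ j) y = ∑ i, hit (r i ∘ₗ LinearMap.mulLeft k (T (T (c i j)))) y := by
      simp [Λ, hit_repr _ (ℛ k y), Finset.sum_smul, Finset.sum_comm (s := Finset.univ)]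
    rw [h1]
    have h2 : ∀ i, hit (r i ∘ₗ LinearMap.mulLeft k (T (T (c i j)))) y =
        ∑ l, ∑ m, r m (T (T (c l j)) * y) • (T (c i l) * c m i) := by
      intro i
      rw [hit_comp_mulLeft _ _ (rd i j)]
      simp [rd, T, hhit, Finset.mul_sum]
    simp_rw [h2]
    rw [Finset.sum_comm]
    have h3 : ∀ l, ∑ i, ∑ m, r m (T (T (c l j)) * y) • (T (c i l) * c m i) =
        r l (T (T (c l j)) * y) • (1 : H) := by
      intro l
      rw [Finset.sum_comm]
      simp_rw [← Finset.smul_sum, hinv]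
      simp
    simp_rw [h3]
    simp [Λ, Finset.sum_smul]
  · rw [hexp ρ hρ y]
    -- The matrix `T(c)` inverts `T²(c)` by `hinv'`, so the basis is recovered from the integrals.
    have h1 : ∀ l, r l y = ∑ j, Λ j (T (c j l) * y) := by
      intro l
      have h2 : ∀ i, ∑ j, r i (T (T (c i j)) * (T (c j l) * y)) =
          r i ((if i = l then 1 else 0) * y) := by
        intro i
        rw [← hinv', Finset.sum_mul, map_sum]
        simp [mul_assoc]
      simp only [Λ, LinearMap.sum_apply, LinearMap.comp_apply, LinearMap.mulLeft_apply]
      rw [Finset.sum_comm]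
      simp_rw [h2]
      simp [apply_ite]
    simp_rw [h1, Finset.mul_sum]
    rw [Finset.sum_comm]
    simp [Finset.sum_mul]

theorem finiteDimensional_range_dualMap_hit {ρ : Module.Dual k H} {ι : Type*} (s : Finset ι)
    (f : ι → Module.Dual k H)
    (h : ∀ q : Module.Dual k H, ∃ a : ι → k, q ∘ₗ hit ρ = ∑ i ∈ s, a i • f i) :
    FiniteDimensional k (LinearMap.range (hit ρ).dualMap) := by
  have hle : LinearMap.range (hit ρ).dualMap ≤ Submodule.span k (f '' s) := by
    rintro _ ⟨q, rfl⟩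
    obtain ⟨a, ha⟩ := h q
    change q ∘ₗ hit ρ ∈ _
    rw [ha]
    exact Submodule.sum_mem _ fun i hi =>
      Submodule.smul_mem _ _ (Submodule.subset_span ⟨i, hi, rfl⟩)
  have : FiniteDimensional k (Submodule.span k (f '' s)) :=
    FiniteDimensional.span_of_finite k (s.finite_toSet.image f)
  exact Submodule.finiteDimensional_of_le hle

end IntegralTranslates

/-! ### The Nakayama automorphism and the square of the antipode -/

section Nakayama

variable {k H : Type*} [Field k] [Ring H] [HopfAlgebra k H] {l : Module.Dual k H}

theorem antipode_hit_integral_comp_mulRight (hl : l ∈ leftIntegrals k H) (h y : H) :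
    antipode k (hit (l ∘ₗ LinearMap.mulRight k h) y) = hit (l ∘ₗ LinearMap.mulLeft k y) h := by
  rw [hit_integral_comp_mulLeft hl h (ℛ k y), hit_repr _ (ℛ k y)]
  simp

theorem hit_integral_comp_mulRight (hS : Function.Bijective (antipode k : H →ₗ[k] H))
    (hl : l ∈ leftIntegrals k H) (y : H) {h : H} {ι : Type*} (r : Repr k h ι) :
    hit (l ∘ₗ LinearMap.mulRight k h) y =
      ∑ i ∈ r.index, l (y * r.right i) • antipodeInv hS (r.left i) := by
  rw [← antipodeInv_antipode hS (hit _ y), antipode_hit_integral_comp_mulRight hl, hit_repr _ r]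
  simp

/-- By `hit_integral_comp_mulRight` the functional `l(· h)` generates a submodule spanned by the
finitely many `l(· h₂)`. It is therefore a sum of translates of integrals, all of which are
multiples of `l`. -/
theorem exists_integral_mul_swap (hS : Function.Bijective (antipode k : H →ₗ[k] H))
    (hl : l ∈ leftIntegrals k H) (hl0 : l ≠ 0) (h : H) :
    ∃ h', ∀ m, l (m * h) = l (h' * m) := by
  have := finiteDimensional_range_dualMap_hit (ρ := l ∘ₗ LinearMap.mulRight k h)
    (ℛ k h).index (fun i => l ∘ₗ LinearMap.mulRight k ((ℛ k h).right i)) fun q =>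
    ⟨fun i => q (antipodeInv hS ((ℛ k h).left i)), LinearMap.ext fun y => by
      simp [hit_integral_comp_mulRight hS hl y (ℛ k h), mul_comm]⟩
  obtain ⟨n, m, b, hm, hb⟩ := exists_sum_integral_mulLeft hS (l ∘ₗ LinearMap.mulRight k h)
  choose c hc using fun j => exists_eq_smul_integral hS hl hl0 (hm j)
  refine ⟨∑ j, c j • b j, fun y => ?_⟩
  have := hb y
  simp only [hc] at this
  simpa [Finset.sum_mul] using this

/-- Computing `y₁ l(χ(h)y₂) = y₁ l(y₂h)` by the two exchange rules and cancelling `l` gives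
`S(χ(h)₁) ⊗ χ(h)₂ = S⁻¹(h₁) ⊗ χ(h₂)`. It remains to apply `id ⊗ ε` and then `S`. -/
theorem antipode_antipode_of_integral_mul_swap
    (hS : Function.Bijective (antipode k : H →ₗ[k] H)) (hl : l ∈ leftIntegrals k H) (hl0 : l ≠ 0)
    (χ : H →ₗ[k] H) (hχ : ∀ h m, l (m * h) = l (χ h * m)) (h : H) :
    antipode k (antipode k (χ h)) = hit (counit (R := k) ∘ₗ χ) h := by
  have h1 : TensorProduct.map (antipode k) LinearMap.id (comul (χ h)) =
      TensorProduct.map (antipodeInv hS) χ (comul h) := by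
    refine tensor_eq_of_integral_mul_eq hS hl hl0 fun y => ?_
    have e1 : sliceRight (l ∘ₗ LinearMap.mulRight k y)
        (TensorProduct.map (antipode k) LinearMap.id (comul (χ h))) =
        hit (l ∘ₗ LinearMap.mulLeft k (χ h)) y := by
      rw [hit_integral_comp_mulLeft hl y (ℛ k (χ h))]
      conv_lhs => rw [← (ℛ k (χ h)).eq]
      simp
    have e2 : sliceRight (l ∘ₗ LinearMap.mulRight k y)
        (TensorProduct.map (antipodeInv hS) χ (comul h)) =
        hit (l ∘ₗ LinearMap.mulRight k h) y := by
      rw [hit_integral_comp_mulRight hS hl y (ℛ k h), ← (ℛ k h).eq]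
      simp [← hχ]
    have e3 : l ∘ₗ LinearMap.mulLeft k (χ h) = l ∘ₗ LinearMap.mulRight k h :=
      LinearMap.ext fun m => (hχ h m).symm
    rw [e1, e2, e3]
  have h2 := congrArg (fun t => antipode k (sliceRight (counit (R := k) (A := H)) t)) h1
  have e4 : sliceRight (counit (R := k) (A := H))
      (TensorProduct.map (antipode k) LinearMap.id (comul (χ h))) = antipode k (χ h) := by
    have := congrArg (antipode k) (LinearMap.congr_fun (hit_counit (k := k) (C := H)) (χ h))
    rw [hit_repr _ (ℛ k (χ h))] at this
    conv_lhs => rw [← (ℛ k (χ h)).eq]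
    simpa using this
  simp only [e4] at h2
  rw [h2, hit_repr _ (ℛ k h), ← (ℛ k h).eq]
  simp

theorem hit_comp_hit_antipode (α : H →ₐ[k] k) :
    hit α.toLinearMap ∘ₗ hit (α.toLinearMap ∘ₗ antipode k) = LinearMap.id := by
  rw [hit_comp_hit, ← hit_counit]
  congr 1
  ext x
  have := congrArg α (sum_mul_antipode_eq_algebraMap_counit (ℛ k x))
  simpa [hit_repr _ (ℛ k x), mul_comm] using this

theorem hit_antipode_comp_hit (α : H →ₐ[k] k) :
    hit (α.toLinearMap ∘ₗ antipode k) ∘ₗ hit α.toLinearMap = LinearMap.id := by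
  rw [hit_comp_hit, ← hit_counit]
  congr 1
  ext x
  have := congrArg α (sum_antipode_mul_eq_algebraMap_counit (ℛ k x))
  simpa [hit_repr _ (ℛ k x), mul_comm] using this

theorem bijective_hit_algHom (α : H →ₐ[k] k) : Function.Bijective (hit α.toLinearMap) :=
  Function.bijective_iff_has_inverse.mpr ⟨hit (α.toLinearMap ∘ₗ antipode k),
    LinearMap.congr_fun (hit_antipode_comp_hit α), LinearMap.congr_fun (hit_comp_hit_antipode α)⟩

theorem exists_isNakayama (hS : Function.Bijective (antipode k : H →ₗ[k] H))
    (hl : l ∈ leftIntegrals k H) (hl0 : l ≠ 0) : ∃ χ : H ≃ₐ[k] H, IsNakayama χ := by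
  choose f hf using exists_integral_mul_swap hS hl hl0
  let F : H →ₗ[k] H :=
    { toFun := f
      map_add' := fun a b => eq_of_integral_mul_eq hS hl hl0 fun x => by
        simp [← hf, mul_add, add_mul]
      map_smul' := fun a b => eq_of_integral_mul_eq hS hl hl0 fun x => by
        simp [← hf] }
  let A : H →ₐ[k] H := AlgHom.ofLinearMap F
    (eq_of_integral_mul_eq hS hl hl0 fun x => by simp [F, ← hf])
    (fun a b => eq_of_integral_mul_eq hS hl hl0 fun x => by
      change l (f (a * b) * x) = l (f a * f b * x)
      rw [← hf, ← mul_assoc, hf b, ← mul_assoc, hf a, ← mul_assoc])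
  -- `S² ∘ A` is the action of the character `ε ∘ A`, invertible since `ε ∘ A` has a convolution
  -- inverse; `S²` is bijective as well.
  have hbij : Function.Bijective A := by
    have h1 : (antipode k ∘ antipode k : H → H) ∘ A =
        hit ((Bialgebra.counitAlgHom k H).comp A).toLinearMap :=
      funext fun h => antipode_antipode_of_integral_mul_swap hS hl hl0 F hf h
    have h2 := bijective_hit_algHom ((Bialgebra.counitAlgHom k H).comp A)
    rw [← h1] at h2
    exact (Function.Bijective.of_comp_iff' (hS.comp hS) A).mp h2
  refine ⟨AlgEquiv.ofBijective A hbij, fun m hm h x => ?_⟩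
  obtain ⟨c, rfl⟩ := exists_eq_smul_integral hS hl hl0 hm
  rw [LinearMap.smul_apply, LinearMap.smul_apply, hf]
  rfl

theorem existsUnique_isNakayama (hS : Function.Bijective (antipode k : H →ₗ[k] H))
    (hl : l ∈ leftIntegrals k H) (hl0 : l ≠ 0) : ∃! χ : H ≃ₐ[k] H, IsNakayama χ := by
  obtain ⟨χ, hχ⟩ := exists_isNakayama hS hl hl0
  refine ⟨χ, hχ, fun χ' hχ' => AlgEquiv.ext fun h => ?_⟩
  exact eq_of_integral_mul_eq hS hl hl0 fun x => by rw [← hχ l hl, ← hχ' l hl]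

theorem IsNakayama.antipode_antipode_apply {χ : H ≃ₐ[k] H} (hχ : IsNakayama χ)
    (hS : Function.Bijective (antipode k : H →ₗ[k] H))
    (hl : l ∈ leftIntegrals k H) (hl0 : l ≠ 0) (h : H) :
    antipode k (antipode k (χ h)) = hit (modularFunctional χ).toLinearMap h :=
  antipode_antipode_of_integral_mul_swap hS hl hl0 χ.toLinearMap (hχ l hl) h

end Nakayama

/-! ### Restriction of integrals to a sub-Hopf algebra -/

namespace SubHopfAlgebra

variable {k H : Type*} [Field k] [Ring H] [HopfAlgebra k H] (L : SubHopfAlgebra k H)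

theorem inclTensor_comul (x : L.toSubalgebra) :
    L.inclTensor (comul (R := k) x) = comul (R := k) (x : H) :=
  L.inclTensor_comulHom x

theorem coe_antipode (x : L.toSubalgebra) :
    ((antipode k x : L.toSubalgebra) : H) = antipode k (x : H) := rfl

theorem sliceRight_inclTensor (p : Module.Dual k H) (t : L.toSubalgebra ⊗[k] L.toSubalgebra) :
    sliceRight p (L.inclTensor t) =
      (sliceRight (p ∘ₗ L.toSubalgebra.val.toLinearMap) t : L.toSubalgebra) := by
  induction t with
  | zero => simp
  | tmul a b => simp [inclTensor]
  | add x y hx hy => simp only [map_add, hx, hy, Subalgebra.coe_add]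

theorem sliceLeft_inclTensor (p : Module.Dual k H) (t : L.toSubalgebra ⊗[k] L.toSubalgebra) :
    sliceLeft p (L.inclTensor t) =
      (sliceLeft (p ∘ₗ L.toSubalgebra.val.toLinearMap) t : L.toSubalgebra) := by
  induction t with
  | zero => simp
  | tmul a b => simp [inclTensor]
  | add x y hx hy => simp only [map_add, hx, hy, Subalgebra.coe_add]

theorem coe_hit (p : Module.Dual k H) (x : L.toSubalgebra) :
    (hit (p ∘ₗ L.toSubalgebra.val.toLinearMap) x : H) = hit p (x : H) := by
  rw [hit, LinearMap.comp_apply, ← sliceRight_inclTensor, inclTensor_comul]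
  rfl

/-- With `l h = 1`, the restriction of `l(h ·)` to `L` is nonzero at `1` and, by the exchange rule,
generates a finite-dimensional submodule. It is thus a sum of translates of left integrals of `L`,
which cannot all vanish. -/
theorem isCoFrobenius (hS : Function.Bijective (antipode k : L.toSubalgebra →ₗ[k] L.toSubalgebra))
    (hH : IsCoFrobenius k H) : IsCoFrobenius k L.toSubalgebra := by
  obtain ⟨l, hl, hl0⟩ := Submodule.exists_mem_ne_zero_of_ne_bot hH
  obtain ⟨h, hh⟩ := exists_integral_eq_one hl0
  let i := L.toSubalgebra.val.toLinearMap
  have := finiteDimensional_range_dualMap_hit (ρ := (l ∘ₗ LinearMap.mulLeft k h) ∘ₗ i)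
    (ℛ k h).index (fun j => (l ∘ₗ LinearMap.mulLeft k ((ℛ k h).right j)) ∘ₗ i) fun q => by
    -- The elements `S(h₁)` need not lie in `L`, so `q` has to be extended to `H` to be evaluated on
    -- them.
    obtain ⟨q', rfl⟩ : ∃ q' : Module.Dual k H, q' ∘ₗ i = q := by
      obtain ⟨q', hq'⟩ := LinearMap.exists_extend (p := Subalgebra.toSubmodule L.toSubalgebra) q
      exact ⟨q', hq'⟩
    refine ⟨fun j => q' (antipode k ((ℛ k h).left j)), LinearMap.ext fun y => ?_⟩
    change q' (hit ((l ∘ₗ LinearMap.mulLeft k h) ∘ₗ i) y : L.toSubalgebra) = _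
    rw [coe_hit, hit_integral_comp_mulLeft hl _ (ℛ k h)]
    simp [i, mul_comm]
  obtain ⟨n, m, b, hm, hb⟩ :=
    exists_sum_integral_mulLeft hS ((l ∘ₗ LinearMap.mulLeft k h) ∘ₗ i)
  intro hbot
  have h1 := hb 1
  have h2 : ∀ j, m j = 0 := fun j => (Submodule.mem_bot k).mp (hbot ▸ hm j)
  simp [h2, i, hh] at h1

end SubHopfAlgebra

/-! ### Multiplicativity of slices, legs and coproducts of tensors -/

section TensorAlgebra

variable {k H : Type*} [Field k] [Ring H] [HopfAlgebra k H]

/-- Two biadditive expressions in a pair of tensors agree if they agree on pure tensors. -/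
theorem tensor_induction₂ {A B C D M : Type*} [AddCommGroup A] [Module k A] [AddCommGroup B]
    [Module k B] [AddCommGroup C] [Module k C] [AddCommGroup D] [Module k D] [AddCommGroup M]
    [Module k M] {f g : A ⊗[k] B →ₗ[k] C ⊗[k] D →ₗ[k] M}
    (h : ∀ a b c d, f (a ⊗ₜ b) (c ⊗ₜ d) = g (a ⊗ₜ b) (c ⊗ₜ d)) : f = g :=
  TensorProduct.ext' fun a b => TensorProduct.ext' fun c d => h a b c d

theorem sliceRight_mul (α : H →ₐ[k] k) (s t : H ⊗[k] H) :
    sliceRight α.toLinearMap (s * t) =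
      sliceRight α.toLinearMap s * sliceRight α.toLinearMap t := by
  refine LinearMap.congr_fun₂ (tensor_induction₂
    (f := (LinearMap.mul k (H ⊗[k] H)).compr₂ (sliceRight α.toLinearMap))
    (g := (LinearMap.mul k H).compl₁₂ (sliceRight α.toLinearMap) (sliceRight α.toLinearMap))
    fun a b c d => ?_) s t
  simp [smul_smul, mul_comm]

theorem sliceLeft_mul (α : H →ₐ[k] k) (s t : H ⊗[k] H) :
    sliceLeft α.toLinearMap (s * t) = sliceLeft α.toLinearMap s * sliceLeft α.toLinearMap t := by
  refine LinearMap.congr_fun₂ (tensor_induction₂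
    (f := (LinearMap.mul k (H ⊗[k] H)).compr₂ (sliceLeft α.toLinearMap))
    (g := (LinearMap.mul k H).compl₁₂ (sliceLeft α.toLinearMap) (sliceLeft α.toLinearMap))
    fun a b c d => ?_) s t
  simp [smul_smul, mul_comm]

@[simp] theorem sliceRight_one (α : H →ₐ[k] k) :
    sliceRight α.toLinearMap (1 : H ⊗[k] H) = 1 := by
  simp [Algebra.TensorProduct.one_def]

@[simp] theorem sliceLeft_one (α : H →ₐ[k] k) :
    sliceLeft α.toLinearMap (1 : H ⊗[k] H) = 1 := by
  simp [Algebra.TensorProduct.one_def]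

theorem comm_mul (s t : H ⊗[k] H) : TensorProduct.comm k H H (s * t) =
    TensorProduct.comm k H H s * TensorProduct.comm k H H t :=
  map_mul (Algebra.TensorProduct.comm k H H) s t

theorem comm_one : TensorProduct.comm k H H (1 : H ⊗[k] H) = 1 :=
  map_one (Algebra.TensorProduct.comm k H H)

/-- `id ⊗ Δ` as an algebra homomorphism. -/
def lTensorComul : H ⊗[k] H →ₐ[k] H ⊗[k] (H ⊗[k] H) :=
  Algebra.TensorProduct.map (AlgHom.id k H) (Bialgebra.comulAlgHom k H)

/-- `Δ ⊗ id` as an algebra homomorphism. -/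
def rTensorComul : H ⊗[k] H →ₐ[k] H ⊗[k] (H ⊗[k] H) :=
  (Algebra.TensorProduct.assoc k k k H H H).toAlgHom.comp
    (Algebra.TensorProduct.map (Bialgebra.comulAlgHom k H) (AlgHom.id k H))

theorem lTensorComul_apply (t : H ⊗[k] H) : lTensorComul t = LinearMap.lTensor H comul t := rfl

theorem rTensorComul_apply (t : H ⊗[k] H) :
    rTensorComul t = TensorProduct.assoc k H H H (LinearMap.rTensor H comul t) := rfl

/-- `leg12` as an algebra homomorphism. -/
def leg12Hom : H ⊗[k] H →ₐ[k] H ⊗[k] (H ⊗[k] H) :=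
  Algebra.TensorProduct.map (AlgHom.id k H) Algebra.TensorProduct.includeLeft

/-- `leg13` as an algebra homomorphism. -/
def leg13Hom : H ⊗[k] H →ₐ[k] H ⊗[k] (H ⊗[k] H) :=
  Algebra.TensorProduct.map (AlgHom.id k H) Algebra.TensorProduct.includeRight

/-- `leg23` as an algebra homomorphism. -/
def leg23Hom : H ⊗[k] H →ₐ[k] H ⊗[k] (H ⊗[k] H) := Algebra.TensorProduct.includeRight

theorem leg12Hom_apply (t : H ⊗[k] H) : leg12Hom t = leg12 t := rfl
theorem leg13Hom_apply (t : H ⊗[k] H) : leg13Hom t = leg13 t := rfl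
theorem leg23Hom_apply (t : H ⊗[k] H) : leg23Hom t = leg23 t := rfl

@[simp] theorem leg12Hom_tmul (a b : H) : leg12Hom (k := k) (a ⊗ₜ b) = a ⊗ₜ (b ⊗ₜ 1) := rfl
@[simp] theorem leg13Hom_tmul (a b : H) : leg13Hom (k := k) (a ⊗ₜ b) = a ⊗ₜ (1 ⊗ₜ b) := rfl
@[simp] theorem leg23Hom_tmul (a b : H) : leg23Hom (k := k) (a ⊗ₜ b) = 1 ⊗ₜ (a ⊗ₜ b) := rfl

/-- `a ⊗ b ⊗ c ↦ b ⊗ c ⊗ a`. -/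
def rotateLeft : H ⊗[k] (H ⊗[k] H) →ₗ[k] H ⊗[k] (H ⊗[k] H) :=
  (TensorProduct.assoc k H H H).toLinearMap ∘ₗ (TensorProduct.comm k H (H ⊗[k] H)).toLinearMap

/-- `a ⊗ b ⊗ c ↦ c ⊗ a ⊗ b`. -/
def rotateRight : H ⊗[k] (H ⊗[k] H) →ₗ[k] H ⊗[k] (H ⊗[k] H) :=
  (TensorProduct.comm k (H ⊗[k] H) H).toLinearMap ∘ₗ
    (TensorProduct.assoc k H H H).symm.toLinearMap

@[simp] theorem rotateLeft_tmul (a b c : H) :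
    rotateLeft (a ⊗ₜ[k] (b ⊗ₜ[k] c)) = b ⊗ₜ (c ⊗ₜ a) := by simp [rotateLeft]

@[simp] theorem rotateRight_tmul (a b c : H) :
    rotateRight (a ⊗ₜ[k] (b ⊗ₜ[k] c)) = c ⊗ₜ (a ⊗ₜ b) := by simp [rotateRight]

theorem rTensorComul_comm (t : H ⊗[k] H) :
    rTensorComul (TensorProduct.comm k H H t) = rotateLeft (lTensorComul t) := by
  induction t with
  | zero => simp
  | tmul a b => simp [rTensorComul_apply, lTensorComul_apply, rotateLeft]
  | add x y hx hy => simp only [map_add, hx, hy]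

theorem lTensorComul_comm (t : H ⊗[k] H) :
    lTensorComul (TensorProduct.comm k H H t) = rotateRight (rTensorComul t) := by
  induction t with
  | zero => simp
  | tmul a b => simp [rTensorComul_apply, lTensorComul_apply, rotateRight]
  | add x y hx hy => simp only [map_add, hx, hy]

theorem rotateLeft_leg12_mul_leg13 (s t : H ⊗[k] H) :
    rotateLeft (leg12Hom s * leg13Hom t) =
      leg13Hom (TensorProduct.comm k H H s) * leg23Hom (TensorProduct.comm k H H t) := by
  refine LinearMap.congr_fun₂ (tensor_induction₂
    (f := ((LinearMap.mul k _).compl₁₂ leg12Hom.toLinearMap leg13Hom.toLinearMap).compr₂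
      rotateLeft)
    (g := (LinearMap.mul k _).compl₁₂
      (leg13Hom.toLinearMap ∘ₗ (TensorProduct.comm k H H).toLinearMap)
      (leg23Hom.toLinearMap ∘ₗ (TensorProduct.comm k H H).toLinearMap))
    fun a b c d => ?_) s t
  simp

theorem rotateRight_leg23_mul_leg13 (s t : H ⊗[k] H) :
    rotateRight (leg23Hom s * leg13Hom t) =
      leg13Hom (TensorProduct.comm k H H s) * leg12Hom (TensorProduct.comm k H H t) := by
  refine LinearMap.congr_fun₂ (tensor_induction₂
    (f := ((LinearMap.mul k _).compl₁₂ leg23Hom.toLinearMap leg13Hom.toLinearMap).compr₂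
      rotateRight)
    (g := (LinearMap.mul k _).compl₁₂
      (leg13Hom.toLinearMap ∘ₗ (TensorProduct.comm k H H).toLinearMap)
      (leg12Hom.toLinearMap ∘ₗ (TensorProduct.comm k H H).toLinearMap))
    fun a b c d => ?_) s t
  simp

end TensorAlgebra

/-! ### Quasitriangular structures and the Drinfeld element -/

section Quasitriangular

variable {k H : Type*} [Field k] [Ring H] [HopfAlgebra k H] {R : H ⊗[k] H}

namespace IsQuasitriangular

theorem sliceRight_counit (hR : IsQuasitriangular R) :
    sliceRight (Bialgebra.counitAlgHom k H).toLinearMap R = 1 := hR.counit_right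

theorem sliceLeft_counit (hR : IsQuasitriangular R) :
    sliceLeft (Bialgebra.counitAlgHom k H).toLinearMap R = 1 := hR.counit_left

/-- `R₂₁⁻¹` is again a quasitriangular structure. -/
theorem comm_inv (hR : IsQuasitriangular R) {Q : H ⊗[k] H} (h1 : Q * R = 1) (h2 : R * Q = 1) :
    IsQuasitriangular (TensorProduct.comm k H H Q) where
  isUnit := by
    refine ⟨⟨TensorProduct.comm k H H Q, TensorProduct.comm k H H R, ?_, ?_⟩, rfl⟩
    · rw [← comm_mul, h1, comm_one]
    · rw [← comm_mul, h2, comm_one]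
  comul_cop h := by
    have h3 : Q * TensorProduct.comm k H H (comul h) = comul h * Q := by
      calc _ = Q * (TensorProduct.comm k H H (comul h) * R) * Q := by
            rw [mul_assoc, mul_assoc, h2, mul_one]
        _ = comul h * Q := by rw [hR.comul_cop, ← mul_assoc, h1, one_mul]
    have h4 := congrArg (TensorProduct.comm k H H) h3
    rw [comm_mul, comm_mul] at h4
    rw [← h4]
    congr 1
    exact TensorProduct.comm_comm k H H _
  comul_left := by
    -- Inverting `R₁₃R₁₂` reverses the factors; the flip then turns this into the other hexagon
    -- identity.
    have h3 : lTensorComul Q = leg12Hom Q * leg13Hom Q := by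
      refine left_inv_eq_right_inv (a := lTensorComul R) (by rw [← map_mul, h1, map_one]) ?_
      rw [lTensorComul_apply, hR.comul_right, ← leg12Hom_apply, ← leg13Hom_apply, mul_assoc,
        ← mul_assoc (leg12Hom R), ← map_mul leg12Hom, h2, map_one, one_mul, ← map_mul, h2, map_one]
    rw [← rTensorComul_apply, rTensorComul_comm, h3, rotateLeft_leg12_mul_leg13]
    rfl
  comul_right := by
    have h3 : rTensorComul Q = leg23Hom Q * leg13Hom Q := by
      refine left_inv_eq_right_inv (a := rTensorComul R) (by rw [← map_mul, h1, map_one]) ?_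
      rw [rTensorComul_apply, hR.comul_left, ← leg23Hom_apply, ← leg13Hom_apply, mul_assoc,
        ← mul_assoc (leg23Hom R), ← map_mul leg23Hom, h2, map_one, one_mul, ← map_mul, h2, map_one]
    rw [← lTensorComul_apply, lTensorComul_comm, h3, rotateRight_leg23_mul_leg13]
    rfl
  counit_left := by
    have h3 := sliceRight_mul (Bialgebra.counitAlgHom k H) Q R
    rw [h1, hR.sliceRight_counit, mul_one, sliceRight_one] at h3
    exact (sliceLeft_comm _ Q).trans h3.symm
  counit_right := by
    have h3 := sliceLeft_mul (Bialgebra.counitAlgHom k H) Q R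
    rw [h1, hR.sliceLeft_counit, mul_one, sliceLeft_one] at h3
    have h4 := sliceLeft_comm (Bialgebra.counitAlgHom k H).toLinearMap
      (TensorProduct.comm k H H Q)
    rw [TensorProduct.comm_comm] at h4
    exact h4.symm.trans h3.symm

/-- Multiply the first two legs of `(Δ ⊗ id)R = R₁₃R₂₃` after applying `S` to the first. -/
theorem rTensor_antipode_mul (hR : IsQuasitriangular R) :
    LinearMap.rTensor H (antipode k) R * R = 1 := by
  let Θ : H ⊗[k] (H ⊗[k] H) →ₗ[k] H ⊗[k] H :=
    LinearMap.rTensor H (LinearMap.mul' k H ∘ₗ LinearMap.rTensor H (antipode k)) ∘ₗ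
      (TensorProduct.assoc k H H H).symm.toLinearMap
  have h1 : ∀ s t : H ⊗[k] H, Θ (leg13Hom s * leg23Hom t) =
      LinearMap.rTensor H (antipode k) s * t := by
    intro s t
    refine LinearMap.congr_fun₂ (tensor_induction₂
      (f := ((LinearMap.mul k _).compl₁₂ leg13Hom.toLinearMap leg23Hom.toLinearMap).compr₂ Θ)
      (g := (LinearMap.mul k _).compl₁₂ (LinearMap.rTensor H (antipode k)) LinearMap.id)
      fun a b c d => ?_) s t
    simp [Θ]
  have h2 : ∀ t : H ⊗[k] H, Θ (rTensorComul t) =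
      1 ⊗ₜ sliceLeft (Bialgebra.counitAlgHom k H).toLinearMap t := by
    intro t
    induction t with
    | zero => simp
    | tmul a b =>
      simp [rTensorComul_apply, Θ, Algebra.algebraMap_eq_smul_one, TensorProduct.smul_tmul]
    | add x y hx hy => simp only [map_add, TensorProduct.tmul_add, hx, hy]
  rw [← h1, leg13Hom_apply, leg23Hom_apply, ← hR.comul_left, ← rTensorComul_apply, h2,
    hR.sliceLeft_counit]
  rfl

theorem mul_rTensor_antipode (hR : IsQuasitriangular R) :
    R * LinearMap.rTensor H (antipode k) R = 1 := by
  obtain ⟨U, rfl⟩ := hR.isUnit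
  rw [← Units.inv_eq_of_mul_eq_one_left hR.rTensor_antipode_mul, Units.mul_inv]

/-- The previous formula for `R₂₁⁻¹` shows that `(S ⊗ S)R` is a left inverse of `R⁻¹`. -/
theorem map_antipode_antipode (hR : IsQuasitriangular R) :
    TensorProduct.map (antipode k) (antipode k) R = R := by
  have h1 := (hR.comm_inv hR.rTensor_antipode_mul hR.mul_rTensor_antipode).rTensor_antipode_mul
  have e : ∀ t : H ⊗[k] H, LinearMap.rTensor H (antipode k) (TensorProduct.comm k H H
      (LinearMap.rTensor H (antipode k) t)) =
      TensorProduct.comm k H H (TensorProduct.map (antipode k) (antipode k) t) := by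
    intro t
    induction t with
    | zero => simp
    | tmul a b => simp
    | add x y hx hy => simp only [map_add, hx, hy]
  rw [e, ← comm_mul, ← comm_one] at h1
  exact left_inv_eq_right_inv ((TensorProduct.comm k H H).injective h1) hR.rTensor_antipode_mul

end IsQuasitriangular

/-- `a ⊗ b ↦ S(b) a`. -/
def antipodeMulSwap : H ⊗[k] H →ₗ[k] H :=
  LinearMap.mul' k H ∘ₗ (TensorProduct.comm k H H).toLinearMap ∘ₗ LinearMap.lTensor H (antipode k)

@[simp] theorem antipodeMulSwap_tmul (a b : H) :
    antipodeMulSwap (a ⊗ₜ[k] b) = antipode k b * a := by simp [antipodeMulSwap]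

/-- `a ⊗ b ↦ a S(b)`. -/
def mulAntipode : H ⊗[k] H →ₗ[k] H := LinearMap.mul' k H ∘ₗ LinearMap.lTensor H (antipode k)

@[simp] theorem mulAntipode_tmul (a b : H) :
    mulAntipode (a ⊗ₜ[k] b) = a * antipode k b := by simp [mulAntipode]

namespace IsQuasitriangular

/-- The Drinfeld element `u = S(R²) R¹` satisfies `u h = S²(h) u`. -/
theorem antipodeMulSwap_mul (hR : IsQuasitriangular R) (h : H) :
    antipodeMulSwap R * h = antipode k (antipode k h) * antipodeMulSwap R := by
  set u := antipodeMulSwap R with hu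
  -- This is `RΔ(x) = Δ^cop(x)R` under `a ⊗ b ↦ S(b)a`.
  have h2 : ∀ x : H, ∑ i ∈ (ℛ k x).index, antipode k ((ℛ k x).right i) * u * (ℛ k x).left i =
      counit (R := k) x • u := by
    intro x
    have e1 : antipodeMulSwap (R * comul x) =
        ∑ i ∈ (ℛ k x).index, antipode k ((ℛ k x).right i) * u * (ℛ k x).left i := by
      have e2 : ∀ (s : H ⊗[k] H) (a b : H), antipodeMulSwap (s * a ⊗ₜ[k] b) =
          antipode k b * antipodeMulSwap s * a := by
        intro s a b
        induction s with
        | zero => simp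
        | tmul c d => simp [antipode_mul_antidistrib, mul_assoc]
        | add x y hx hy => simp only [map_add, add_mul, mul_add, hx, hy]
      conv_lhs => rw [← (ℛ k x).eq]
      simp [Finset.mul_sum, e2, hu]
    have e3 : ∀ s : H ⊗[k] H, antipodeMulSwap (TensorProduct.comm k H H (comul x) * s) =
        counit (R := k) x • antipodeMulSwap s := by
      intro s
      induction s with
      | zero => simp
      | tmul c d =>
        conv_lhs => rw [← (ℛ k x).eq]
        have e4 := congrArg (fun z => antipode k d * z * c) (sum_antipode_mul_eq_smul (ℛ k x))
        simp only [Finset.mul_sum, Finset.sum_mul] at e4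
        simp only [map_sum, TensorProduct.comm_tmul, Finset.sum_mul,
          Algebra.TensorProduct.tmul_mul_tmul, antipodeMulSwap_tmul, antipode_mul_antidistrib]
        simpa [mul_assoc] using e4
      | add x y hx hy => simp only [map_add, mul_add, smul_add, hx, hy]
    rw [← e1, ← hR.comul_cop, e3]
  let f := antipodeAlgHomOp k H
  obtain ⟨X, hX⟩ : ∃ X : H →ₗ[k] Hᵐᵒᵖ, ∀ x, X x = MulOpposite.op (u * x) :=
    ⟨(MulOpposite.opLinearEquiv k).toLinearMap ∘ₗ LinearMap.mulLeft k u, fun _ => rfl⟩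
  obtain ⟨Y, hY⟩ : ∃ Y : H →ₗ[k] Hᵐᵒᵖ, ∀ x, Y x = MulOpposite.op (counit (R := k) x • u) :=
    ⟨(MulOpposite.opLinearEquiv k).toLinearMap ∘ₗ
      (LinearMap.toSpanSingleton k H u ∘ₗ counit), fun _ => rfl⟩
  -- `S` is an algebra map into the opposite algebra, so it is convolution invertible there with
  -- inverse `S²`; this removes `S(x₂)` from `S(x₂)ux₁ = ε(x)u`.
  have h3 : toConv X * toConv f.toLinearMap = toConv Y := by
    ext x
    rw [(ℛ k x).convMul_apply]
    simp only [hX, hY, ← h2 x]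
    simp [f, mul_assoc]
  have h4 : toConv X = toConv Y * toConv (f.toLinearMap ∘ₗ antipode k) := by
    rw [← h3, mul_assoc, algHom_convMul_comp_antipode, mul_one]
  have h5 := congrArg (fun g : WithConv (H →ₗ[k] Hᵐᵒᵖ) => (g h).unop) h4
  simp only [(ℛ k h).convMul_apply, hX, hY] at h5
  have h6 := congrArg (fun z => antipode k (antipode k z) * u) (sum_counit_smul (ℛ k h))
  simp only [map_sum, map_smul, Finset.sum_mul] at h6
  rw [← h6]
  simpa [f] using h5

/-- From `R(S ⊗ id)R = 1` and `(S ⊗ S)R = R` one gets `R²uR¹ = 1`. Moving `u` past either factor by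
`uh = S²(h)u` shows that `R²S²(R¹)` is a two-sided inverse. -/
theorem isUnit_antipodeMulSwap (hR : IsQuasitriangular R) :
    IsUnit (antipodeMulSwap R) := by
  set u := antipodeMulSwap R with hu
  let S2 : H →ₗ[k] H := antipode k ∘ₗ antipode k
  have hS2 : TensorProduct.map S2 S2 R = R := by
    rw [TensorProduct.map_comp, LinearMap.comp_apply, hR.map_antipode_antipode,
      hR.map_antipode_antipode]
  let K : H ⊗[k] H →ₗ[k] H := LinearMap.mul' k H ∘ₗ (TensorProduct.comm k H H).toLinearMap ∘ₗ
    LinearMap.rTensor H (LinearMap.mulLeft k u)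
  let W : H ⊗[k] H →ₗ[k] H :=
    LinearMap.mul' k H ∘ₗ (TensorProduct.comm k H H).toLinearMap ∘ₗ LinearMap.rTensor H S2
  have hK : K R = 1 := by
    have e : ∀ s t : H ⊗[k] H, antipodeMulSwap (s * LinearMap.rTensor H (antipode k) t) =
        (LinearMap.mul' k H ∘ₗ (TensorProduct.comm k H H).toLinearMap ∘ₗ
          LinearMap.rTensor H (LinearMap.mulLeft k (antipodeMulSwap s)))
          (TensorProduct.map (antipode k) (antipode k) t) := by
      intro s t
      induction t with
      | zero => simp
      | tmul a b =>
        induction s with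
        | zero => simp
        | tmul c d => simp [antipode_mul_antidistrib, mul_assoc]
        | add x y hx hy =>
          simp only [add_mul, map_add, hx, hy]
          simp [add_mul, mul_add]
      | add x y hx hy => simp only [map_add, mul_add, hx, hy]
    have h1 := e R R
    rw [hR.mul_rTensor_antipode, hR.map_antipode_antipode] at h1
    change K R = 1
    rw [← h1]
    simp [Algebra.TensorProduct.one_def]
  have h1 : ∀ t : H ⊗[k] H, W t * u = K t := by
    intro t
    induction t with
    | zero => simp
    | tmul a b => simp [W, K, S2, mul_assoc, hu, hR.antipodeMulSwap_mul a]
    | add x y hx hy => simp only [map_add, add_mul, hx, hy]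
  have h2 : ∀ t : H ⊗[k] H, u * W t = K (TensorProduct.map S2 S2 t) := by
    intro t
    induction t with
    | zero => simp
    | tmul a b => simp [W, K, S2, ← mul_assoc, hu, hR.antipodeMulSwap_mul b]
    | add x y hx hy => simp only [map_add, mul_add, hx, hy]
  exact ⟨⟨u, W R, by rw [h2, hS2, hK], by rw [h1, hK]⟩, rfl⟩

/-- `S²` is conjugation by the unit `u`, hence bijective. -/
theorem bijective_antipode (hR : IsQuasitriangular R) :
    Function.Bijective (antipode k : H →ₗ[k] H) := by
  have hu := hR.isUnit_antipodeMulSwap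
  constructor
  · rw [injective_iff_map_eq_zero]
    intro h hh
    have := hR.antipodeMulSwap_mul h
    rw [hh, map_zero, zero_mul] at this
    exact hu.mul_right_eq_zero.mp this
  · intro h
    obtain ⟨U, hU⟩ := hu
    refine ⟨antipode k (↑U⁻¹ * h * U), ?_⟩
    have := hR.antipodeMulSwap_mul (↑U⁻¹ * h * U)
    rw [← hU, ← mul_assoc, ← mul_assoc, Units.mul_inv, one_mul] at this
    exact (U.isUnit.mul_left_injective this).symm

end IsQuasitriangular

end Quasitriangular

/-! ### The formula relating the modular element and the modular functional -/

section ModularElement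

variable {k H : Type*} [Field k] [Ring H] [HopfAlgebra k H] {R : H ⊗[k] H}

/-- The modular element and the modular functional are related through the Drinfeld element `u` by
`R¹ S(R²) = a⁻¹ u R¹ α(R²)`. -/
theorem IsQuasitriangular.mulAntipode_eq (hR : IsQuasitriangular R) {l : Module.Dual k H}
    (hl : l ∈ leftIntegrals k H) (hl0 : l ≠ 0) {a : GroupLike k H} (ha : IsModularElement a)
    {χ : H ≃ₐ[k] H} (hχ : IsNakayama χ) :
    mulAntipode R =
      (a⁻¹).val * antipodeMulSwap R * sliceRight (modularFunctional χ).toLinearMap R := by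
  set g : H := (a⁻¹).val with hg
  have hleg : leg13Hom R * leg12Hom R = lTensorComul R := hR.comul_right.symm
  -- Exchange rule, then `(id ⊗ Δ)R = R₁₃R₁₂`: `R¹h₁ l(R²h₂) = R¹S(R²₁) l(R²₂h)`, which splits as
  -- `R¹ l(R²h) · r¹S(r²)`.
  have h1 : ∀ h : H, sliceRight l (R * comul h) =
      sliceRight (l ∘ₗ LinearMap.mulRight k h) R * mulAntipode R := by
    intro h
    let θ : H ⊗[k] (H ⊗[k] H) →ₗ[k] H := LinearMap.mul' k H ∘ₗ LinearMap.lTensor H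
      (antipode k ∘ₗ sliceRight (l ∘ₗ LinearMap.mulRight k h))
    have e1 : ∀ s : H ⊗[k] H, sliceRight l (s * comul h) = θ (lTensorComul s) := by
      intro s
      induction s with
      | zero => simp
      | tmul p q =>
        have e2 : sliceRight l (p ⊗ₜ[k] q * comul h) = p * hit (l ∘ₗ LinearMap.mulLeft k q) h := by
          rw [hit_repr _ (ℛ k h), ← (ℛ k h).eq]
          simp [Finset.mul_sum]
        rw [e2, hit_integral_comp_mulLeft hl h (ℛ k q), lTensorComul_apply,
          LinearMap.lTensor_tmul]
        conv_rhs => rw [← (ℛ k q).eq]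
        simp [θ, TensorProduct.tmul_sum, Finset.mul_sum]
      | add x y hx hy => simp only [add_mul, map_add, hx, hy]
    have e3 : ∀ s t : H ⊗[k] H, θ (leg13Hom s * leg12Hom t) =
        sliceRight (l ∘ₗ LinearMap.mulRight k h) s * mulAntipode t := by
      intro s t
      induction s with
      | zero => simp
      | tmul a b =>
        induction t with
        | zero => simp
        | tmul c d => simp [θ, mul_assoc]
        | add x y hx hy => simp only [mul_add, map_add, hx, hy]
      | add x y hx hy => simp only [add_mul, map_add, hx, hy]
    rw [e1, ← e3, hleg]
  -- Mirror computation, where the modular element enters: `l(h₁R²)h₂R¹ = l(hR²₁) a⁻¹S(R²₂)R¹`.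
  have h2 : ∀ h : H, sliceRight l (TensorProduct.comm k H H (comul h) * R) =
      g * antipodeMulSwap R * sliceRight (l ∘ₗ LinearMap.mulLeft k h) R := by
    intro h
    let θ : H ⊗[k] (H ⊗[k] H) →ₗ[k] H := LinearMap.mulLeft k g ∘ₗ antipodeMulSwap ∘ₗ
      LinearMap.lTensor H (sliceLeft (l ∘ₗ LinearMap.mulLeft k h))
    have e1 : ∀ s : H ⊗[k] H, sliceRight l (TensorProduct.comm k H H (comul h) * s) =
        θ (lTensorComul s) := by
      intro s
      induction s with
      | zero => simp
      | tmul p q =>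
        have e2 : sliceRight l (TensorProduct.comm k H H (comul h) * p ⊗ₜ[k] q) =
            hitLeft (l ∘ₗ LinearMap.mulRight k q) h * p := by
          rw [hitLeft_repr _ (ℛ k h), ← (ℛ k h).eq]
          simp [Finset.sum_mul]
        rw [e2, hitLeft_comp_mulRight l h (ℛ k q), lTensorComul_apply, LinearMap.lTensor_tmul]
        conv_rhs => rw [← (ℛ k q).eq]
        simp [θ, TensorProduct.tmul_sum, Finset.sum_mul, ha.hitLeft_eq hl, hg,
          mul_assoc]
      | add x y hx hy => simp only [mul_add, map_add, hx, hy]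
    have e3 : ∀ s t : H ⊗[k] H, θ (leg13Hom s * leg12Hom t) =
        g * antipodeMulSwap s * sliceRight (l ∘ₗ LinearMap.mulLeft k h) t := by
      intro s t
      induction s with
      | zero => simp
      | tmul a b =>
        induction t with
        | zero => simp
        | tmul c d => simp [θ, mul_assoc]
        | add x y hx hy => simp only [mul_add, map_add, hx, hy]
      | add x y hx hy => simp only [add_mul, mul_add, map_add, hx, hy]
    rw [e1, ← e3, hleg]
  -- The Nakayama automorphism brings `h` to the right inside `l` on both sides, so nondegeneracy
  -- removes `l`; `id ⊗ ε` then gives the formula.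
  have h3 : R * (mulAntipode R ⊗ₜ[k] 1) = ((g * antipodeMulSwap R) ⊗ₜ[k] 1) *
      LinearMap.lTensor H χ.toLinearMap R := by
    refine tensor_eq_of_integral_mul_eq hR.bijective_antipode hl hl0 fun h => ?_
    have e1 : ∀ (s : H ⊗[k] H) (v : H), sliceRight (l ∘ₗ LinearMap.mulRight k h)
        (s * (v ⊗ₜ[k] 1)) = sliceRight (l ∘ₗ LinearMap.mulRight k h) s * v := by
      intro s v
      induction s with
      | zero => simp
      | tmul p q => simp
      | add x y hx hy => simp only [add_mul, map_add, hx, hy]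
    have e2 : ∀ (s : H ⊗[k] H) (v : H), sliceRight (l ∘ₗ LinearMap.mulRight k h)
        ((v ⊗ₜ[k] 1) * LinearMap.lTensor H χ.toLinearMap s) =
          v * sliceRight (l ∘ₗ LinearMap.mulLeft k h) s := by
      intro s v
      induction s with
      | zero => simp
      | tmul p q => simp [← hχ l hl]
      | add x y hx hy => simp only [mul_add, map_add, hx, hy]
    rw [e1, e2, ← h1, ← h2, hR.comul_cop]
  have h4 := congrArg (sliceRight (Bialgebra.counitAlgHom k H).toLinearMap) h3
  have h5 : ∀ s : H ⊗[k] H, sliceRight (Bialgebra.counitAlgHom k H).toLinearMap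
      (LinearMap.lTensor H χ.toLinearMap s) = sliceRight (modularFunctional χ).toLinearMap s := by
    intro s
    induction s with
    | zero => simp
    | tmul p q => simp [modularFunctional]
    | add x y hx hy => simp only [map_add, hx, hy]
  rw [sliceRight_mul, sliceRight_mul, hR.sliceRight_counit, h5] at h4
  simpa using h4

end ModularElement

/-! ### Transfer of the quasitriangular structure to `L` -/

namespace SubHopfAlgebra

variable {k H : Type*} [Field k] [Ring H] [HopfAlgebra k H] (L : SubHopfAlgebra k H)

theorem coe_antipodeMulSwap (t : L.toSubalgebra ⊗[k] L.toSubalgebra) :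
    ((antipodeMulSwap t : L.toSubalgebra) : H) = antipodeMulSwap (L.inclTensor t) := by
  induction t with
  | zero => simp
  | tmul a b => simp [inclTensor, coe_antipode]
  | add x y hx hy => simp only [map_add, ← hx, ← hy, Subalgebra.coe_add]

theorem coe_mulAntipode (t : L.toSubalgebra ⊗[k] L.toSubalgebra) :
    ((mulAntipode t : L.toSubalgebra) : H) = mulAntipode (L.inclTensor t) := by
  induction t with
  | zero => simp
  | tmul a b => simp [inclTensor, coe_antipode]
  | add x y hx hy => simp only [map_add, ← hx, ← hy, Subalgebra.coe_add]

theorem inclTensor_comm (t : L.toSubalgebra ⊗[k] L.toSubalgebra) :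
    L.inclTensor (TensorProduct.comm k _ _ t) = TensorProduct.comm k H H (L.inclTensor t) := by
  induction t with
  | zero => simp
  | tmul a b => simp [inclTensor]
  | add x y hx hy => simp only [map_add, hx, hy]

theorem inclTensor_rTensor_antipode (t : L.toSubalgebra ⊗[k] L.toSubalgebra) :
    L.inclTensor (LinearMap.rTensor _ (antipode k) t) =
      LinearMap.rTensor H (antipode k) (L.inclTensor t) := by
  induction t with
  | zero => simp
  | tmul a b => simp [inclTensor, coe_antipode]
  | add x y hx hy => simp only [map_add, hx, hy]

/-- The canonical map `L ⊗ L ⊗ L → H ⊗ H ⊗ H`. -/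
def inclTensor₃ : L.toSubalgebra ⊗[k] (L.toSubalgebra ⊗[k] L.toSubalgebra) →ₐ[k]
    H ⊗[k] (H ⊗[k] H) :=
  Algebra.TensorProduct.map L.toSubalgebra.val L.inclTensor

theorem inclTensor₃_injective : Function.Injective L.inclTensor₃ :=
  TensorProduct.map_injective_of_flat_flat L.toSubalgebra.val.toLinearMap
    L.inclTensor.toLinearMap Subtype.val_injective L.inclTensor_injective

theorem inclTensor₃_lTensorComul (t : L.toSubalgebra ⊗[k] L.toSubalgebra) :
    L.inclTensor₃ (lTensorComul t) = lTensorComul (L.inclTensor t) := by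
  induction t with
  | zero => simp
  | tmul a b =>
    rw [lTensorComul_apply, LinearMap.lTensor_tmul]
    simp [inclTensor₃, inclTensor_comul, lTensorComul_apply]
    simp [inclTensor]
  | add x y hx hy => simp only [map_add, hx, hy]

theorem inclTensor₃_rTensorComul (t : L.toSubalgebra ⊗[k] L.toSubalgebra) :
    L.inclTensor₃ (rTensorComul t) = rTensorComul (L.inclTensor t) := by
  have e : ∀ (s : L.toSubalgebra ⊗[k] L.toSubalgebra) (b : L.toSubalgebra),
      L.inclTensor₃ (TensorProduct.assoc k L.toSubalgebra L.toSubalgebra L.toSubalgebra (s ⊗ₜ b)) =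
        TensorProduct.assoc k H H H (L.inclTensor s ⊗ₜ (b : H)) := by
    intro s b
    have e' : L.inclTensor₃.toLinearMap ∘ₗ (TensorProduct.assoc k L.toSubalgebra L.toSubalgebra
        L.toSubalgebra).toLinearMap = (TensorProduct.assoc k H H H).toLinearMap ∘ₗ
          TensorProduct.map L.inclTensor.toLinearMap L.toSubalgebra.val.toLinearMap :=
      TensorProduct.ext_threefold fun x y z => by simp [inclTensor₃, inclTensor]
    exact LinearMap.congr_fun e' (s ⊗ₜ b)
  induction t with
  | zero => simp
  | tmul a b =>
    rw [rTensorComul_apply, LinearMap.rTensor_tmul, e, inclTensor_comul]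
    simp [inclTensor, rTensorComul_apply]
  | add x y hx hy => simp only [map_add, hx, hy]

theorem inclTensor₃_leg12Hom (t : L.toSubalgebra ⊗[k] L.toSubalgebra) :
    L.inclTensor₃ (leg12Hom t) = leg12Hom (L.inclTensor t) := by
  induction t with
  | zero => simp
  | tmul a b => simp [inclTensor₃, inclTensor]
  | add x y hx hy => simp only [map_add, hx, hy]

theorem inclTensor₃_leg13Hom (t : L.toSubalgebra ⊗[k] L.toSubalgebra) :
    L.inclTensor₃ (leg13Hom t) = leg13Hom (L.inclTensor t) := by
  induction t with
  | zero => simp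
  | tmul a b => simp [inclTensor₃, inclTensor]
  | add x y hx hy => simp only [map_add, hx, hy]

theorem inclTensor₃_leg23Hom (t : L.toSubalgebra ⊗[k] L.toSubalgebra) :
    L.inclTensor₃ (leg23Hom t) = leg23Hom (L.inclTensor t) := by
  induction t with
  | zero => simp
  | tmul a b => simp [inclTensor₃, inclTensor]
  | add x y hx hy => simp only [map_add, hx, hy]

theorem isQuasitriangular {Q : L.toSubalgebra ⊗[k] L.toSubalgebra}
    (hQ : IsQuasitriangular (L.inclTensor Q)) : IsQuasitriangular Q where
  isUnit := by
    -- `R⁻¹ = (S ⊗ id)R` already lies in `L ⊗ L`, as `L` is stable under `S`.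
    refine ⟨⟨Q, LinearMap.rTensor _ (antipode k) Q, L.inclTensor_injective ?_,
      L.inclTensor_injective ?_⟩, rfl⟩
    · rw [map_mul, inclTensor_rTensor_antipode, hQ.mul_rTensor_antipode, map_one]
    · rw [map_mul, inclTensor_rTensor_antipode, hQ.rTensor_antipode_mul, map_one]
  comul_cop h := by
    apply L.inclTensor_injective
    rw [map_mul, map_mul, inclTensor_comm, inclTensor_comul, hQ.comul_cop]
  comul_left := by
    apply L.inclTensor₃_injective
    rw [← rTensorComul_apply, inclTensor₃_rTensorComul, rTensorComul_apply, hQ.comul_left,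
      map_mul]
    exact congrArg₂ (· * ·) (L.inclTensor₃_leg13Hom Q).symm (L.inclTensor₃_leg23Hom Q).symm
  comul_right := by
    apply L.inclTensor₃_injective
    rw [← lTensorComul_apply, inclTensor₃_lTensorComul, lTensorComul_apply, hQ.comul_right,
      map_mul]
    exact congrArg₂ (· * ·) (L.inclTensor₃_leg13Hom Q).symm (L.inclTensor₃_leg12Hom Q).symm
  counit_left := Subtype.val_injective <|
    (L.sliceLeft_inclTensor counit Q).symm.trans hQ.counit_left
  counit_right := Subtype.val_injective <|
    (L.sliceRight_inclTensor counit Q).symm.trans hQ.counit_right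

end SubHopfAlgebra

/-- A tensor lies in `P ⊗ Q` if its slices lie in `P` and `Q`. -/
theorem mem_range_map_subtype_of_slices {k V W : Type*} [Field k] [AddCommGroup V] [Module k V]
    [AddCommGroup W] [Module k W] (P : Submodule k V) (Q : Submodule k W) (t : V ⊗[k] W)
    (hP : ∀ p : Module.Dual k W, sliceRight p t ∈ P)
    (hQ : ∀ p : Module.Dual k V, sliceLeft p t ∈ Q) :
    ∃ s, TensorProduct.map P.subtype Q.subtype s = t := by
  obtain ⟨π, hπ⟩ := P.subtype.exists_leftInverse_of_injective P.ker_subtype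
  obtain ⟨τ, hτ⟩ := Q.subtype.exists_leftInverse_of_injective Q.ker_subtype
  have e1 : ∀ (f : V →ₗ[k] V) (p : Module.Dual k W) (t : V ⊗[k] W),
      sliceRight p (LinearMap.rTensor W f t) = f (sliceRight p t) := by
    intro f p t
    induction t with
    | zero => simp
    | tmul a b => simp
    | add x y hx hy => simp only [map_add, hx, hy]
  have e2 : ∀ (f : W →ₗ[k] W) (p : Module.Dual k V) (t : V ⊗[k] W),
      sliceLeft p (LinearMap.lTensor V f t) = f (sliceLeft p t) := by
    intro f p t
    induction t with
    | zero => simp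
    | tmul a b => simp
    | add x y hx hy => simp only [map_add, hx, hy]
  -- A linear projection onto `P` fixes every slice of `t`, hence `t`; likewise for `Q`.
  have h1 : LinearMap.rTensor W (P.subtype ∘ₗ π) t = t := by
    rw [← sub_eq_zero]
    refine eq_zero_of_sliceRight_eq_zero _ fun p => ?_
    rw [map_sub, e1, sub_eq_zero]
    exact congrArg Subtype.val (LinearMap.congr_fun hπ ⟨_, hP p⟩)
  have h2 : LinearMap.lTensor V (Q.subtype ∘ₗ τ) t = t := by
    rw [← sub_eq_zero]
    refine eq_zero_of_sliceLeft_eq_zero _ fun p => ?_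
    rw [map_sub, e2, sub_eq_zero]
    exact congrArg Subtype.val (LinearMap.congr_fun hτ ⟨_, hQ p⟩)
  refine ⟨TensorProduct.map π τ t, ?_⟩
  rw [← LinearMap.comp_apply, ← TensorProduct.map_comp, ← LinearMap.rTensor_comp_lTensor,
    LinearMap.comp_apply, h2, h1]

/-! ### The minimal sub-Hopf algebra is generated by slices -/

section SliceAlgebra

variable {k H : Type*} [Field k] [Ring H] [HopfAlgebra k H]

/-- The subalgebra generated by the slices of a tensor. -/
def sliceAlgebra (R : H ⊗[k] H) : Subalgebra k H :=
  Algebra.adjoin k (Set.range (fun p : Module.Dual k H => sliceLeft p R) ∪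
    Set.range (fun p : Module.Dual k H => sliceRight p R))

variable {R : H ⊗[k] H}

theorem sliceLeft_mem_sliceAlgebra (p : Module.Dual k H) : sliceLeft p R ∈ sliceAlgebra R :=
  Algebra.subset_adjoin (Or.inl ⟨p, rfl⟩)

theorem sliceRight_mem_sliceAlgebra (p : Module.Dual k H) : sliceRight p R ∈ sliceAlgebra R :=
  Algebra.subset_adjoin (Or.inr ⟨p, rfl⟩)

theorem sliceAlgebra_le {A : Subalgebra k H} (h1 : ∀ p : Module.Dual k H, sliceLeft p R ∈ A)
    (h2 : ∀ p : Module.Dual k H, sliceRight p R ∈ A) : sliceAlgebra R ≤ A := by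
  refine Algebra.adjoin_le ?_
  rintro _ (⟨p, rfl⟩ | ⟨p, rfl⟩)
  · exact h1 p
  · exact h2 p

theorem mem_range_map_sliceAlgebra : R ∈
    (Algebra.TensorProduct.map (sliceAlgebra R).val (sliceAlgebra R).val).range := by
  obtain ⟨s, hs⟩ := mem_range_map_subtype_of_slices (Subalgebra.toSubmodule (sliceAlgebra R))
    (Subalgebra.toSubmodule (sliceAlgebra R)) R sliceRight_mem_sliceAlgebra
    sliceLeft_mem_sliceAlgebra
  exact ⟨s, hs⟩

section Legs

variable (A : Subalgebra k H)

/-- The image of `A ⊗ A ⊗ A` in `H ⊗ H ⊗ H`. -/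
def tensorCube : Subalgebra k (H ⊗[k] (H ⊗[k] H)) :=
  (Algebra.TensorProduct.map A.val (Algebra.TensorProduct.map A.val A.val)).range

variable {A}

theorem leg_mem_tensorCube {t : H ⊗[k] H}
    (ht : t ∈ (Algebra.TensorProduct.map A.val A.val).range) :
    leg12Hom t ∈ tensorCube A ∧ leg13Hom t ∈ tensorCube A ∧ leg23Hom t ∈ tensorCube A := by
  obtain ⟨s, rfl⟩ := ht
  induction s with
  | zero => simp
  | tmul a b =>
    exact ⟨⟨a ⊗ₜ (b ⊗ₜ 1), by simp⟩, ⟨a ⊗ₜ (1 ⊗ₜ b), by simp⟩, ⟨1 ⊗ₜ (a ⊗ₜ b), by simp⟩⟩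
  | add x y hx hy =>
    simp only [map_add] at hx hy ⊢
    exact ⟨add_mem hx.1 hy.1, add_mem hx.2.1 hy.2.1, add_mem hx.2.2 hy.2.2⟩

theorem sliceLeft_mem_of_mem_tensorCube (p : Module.Dual k H) {z : H ⊗[k] (H ⊗[k] H)}
    (hz : z ∈ tensorCube A) :
    sliceLeft p z ∈ (Algebra.TensorProduct.map A.val A.val).range := by
  obtain ⟨s, rfl⟩ := hz
  induction s with
  | zero => simp
  | tmul a b => exact ⟨p a • b, by simp⟩
  | add x y hx hy =>
    simp only [map_add] at hx hy ⊢
    exact add_mem hx hy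

theorem lTensor_sliceRight_mem_of_mem_tensorCube (p : Module.Dual k H) {z : H ⊗[k] (H ⊗[k] H)}
    (hz : z ∈ tensorCube A) :
    LinearMap.lTensor H (sliceRight p) z ∈ (Algebra.TensorProduct.map A.val A.val).range := by
  obtain ⟨s, rfl⟩ := hz
  induction s with
  | zero => simp
  | tmul a b =>
    induction b with
    | zero => simp
    | tmul b c => exact ⟨a ⊗ₜ (p c • b), by simp⟩
    | add x y hx hy =>
      simp only [map_add, TensorProduct.tmul_add] at hx hy ⊢
      exact add_mem hx hy
  | add x y hx hy =>
    simp only [map_add] at hx hy ⊢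
    exact add_mem hx hy

theorem comul_sliceLeft (p : Module.Dual k H) (t : H ⊗[k] H) :
    comul (R := k) (sliceLeft p t) = sliceLeft p (lTensorComul t) := by
  induction t with
  | zero => simp
  | tmul a b => simp [lTensorComul_apply]
  | add x y hx hy => simp only [map_add, hx, hy]

theorem comul_sliceRight (p : Module.Dual k H) (t : H ⊗[k] H) :
    comul (R := k) (sliceRight p t) = LinearMap.lTensor H (sliceRight p) (rTensorComul t) := by
  induction t with
  | zero => simp
  | tmul a b =>
    rw [rTensorComul_apply, LinearMap.rTensor_tmul, sliceRight_tmul, map_smul]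
    generalize (comul a : H ⊗[k] H) = s
    induction s with
    | zero => simp
    | tmul c d => simp
    | add x y hx hy => simp only [map_add, TensorProduct.add_tmul, smul_add, hx, hy]
  | add x y hx hy => simp only [map_add, hx, hy]

end Legs

theorem antipode_sliceLeft (hS : Function.Bijective (antipode k : H →ₗ[k] H))
    (p : Module.Dual k H) (t : H ⊗[k] H) : antipode k (sliceLeft p t) =
      sliceLeft (p ∘ₗ antipodeInv hS) (TensorProduct.map (antipode k) (antipode k) t) := by
  induction t with
  | zero => simp
  | tmul a b => simp
  | add x y hx hy => simp only [map_add, hx, hy]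

theorem antipode_sliceRight (hS : Function.Bijective (antipode k : H →ₗ[k] H))
    (p : Module.Dual k H) (t : H ⊗[k] H) : antipode k (sliceRight p t) =
      sliceRight (p ∘ₗ antipodeInv hS) (TensorProduct.map (antipode k) (antipode k) t) := by
  induction t with
  | zero => simp
  | tmul a b => simp
  | add x y hx hy => simp only [map_add, hx, hy]

namespace IsQuasitriangular

/-- The slices of a quasitriangular structure generate a sub-Hopf algebra. -/
def sliceSubHopfAlgebra (hR : IsQuasitriangular R) : SubHopfAlgebra k H where
  toSubalgebra := sliceAlgebra R
  comul_mem' := by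
    have h12 := (leg_mem_tensorCube (mem_range_map_sliceAlgebra (R := R))).1
    have h13 := (leg_mem_tensorCube (mem_range_map_sliceAlgebra (R := R))).2.1
    have h23 := (leg_mem_tensorCube (mem_range_map_sliceAlgebra (R := R))).2.2
    -- The coproduct of a slice of `R` is a slice of `R₁₃R₁₂` or `R₁₃R₂₃`, both in the cube of the
    -- slice algebra.
    have h1 : lTensorComul R ∈ tensorCube (sliceAlgebra R) := by
      rw [lTensorComul_apply, hR.comul_right]
      exact mul_mem h13 h12
    have h2 : rTensorComul R ∈ tensorCube (sliceAlgebra R) := by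
      rw [rTensorComul_apply, hR.comul_left]
      exact mul_mem h13 h23
    have h3 : sliceAlgebra R ≤ (Algebra.TensorProduct.map (sliceAlgebra R).val
        (sliceAlgebra R).val).range.comap (Bialgebra.comulAlgHom k H) := by
      refine sliceAlgebra_le (fun p => ?_) fun p => ?_
      · rw [Subalgebra.mem_comap, Bialgebra.comulAlgHom_apply, comul_sliceLeft]
        exact sliceLeft_mem_of_mem_tensorCube p h1
      · rw [Subalgebra.mem_comap, Bialgebra.comulAlgHom_apply, comul_sliceRight]
        exact lTensor_sliceRight_mem_of_mem_tensorCube p h2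
    exact fun x hx => h3 hx
  antipode_mem' := by
    intro x hx
    refine Algebra.adjoin_induction (p := fun y _ => antipode k y ∈ sliceAlgebra R)
      ?_ ?_ ?_ ?_ hx
    · rintro _ (⟨p, rfl⟩ | ⟨p, rfl⟩)
      · change antipode k (sliceLeft p R) ∈ _
        -- Since `(S ⊗ S)R = R`, the antipode sends the slice by `p` to the slice by `p ∘ S⁻¹`.
        rw [antipode_sliceLeft hR.bijective_antipode, hR.map_antipode_antipode]
        exact sliceLeft_mem_sliceAlgebra _
      · change antipode k (sliceRight p R) ∈ _
        rw [antipode_sliceRight hR.bijective_antipode, hR.map_antipode_antipode]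
        exact sliceRight_mem_sliceAlgebra _
    · intro r
      rw [Algebra.algebraMap_eq_smul_one, map_smul, antipode_one]
      exact Subalgebra.smul_mem _ (one_mem _) r
    · intro a b _ _ ha hb
      rw [map_add]
      exact add_mem ha hb
    · intro a b _ _ ha hb
      rw [antipode_mul_antidistrib]
      exact mul_mem hb ha

end IsQuasitriangular

/-- Any sub-Hopf algebra whose tensor square contains `R` contains all slices of `R`, so minimality
leaves no room. -/
theorem IsMinimalQuasitriangular.eq_sliceAlgebra (hR : IsQuasitriangular R)
    {L : SubHopfAlgebra k H} (hL : IsMinimalQuasitriangular R L) :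
    sliceAlgebra R = L.toSubalgebra := by
  refine hL.2 hR.sliceSubHopfAlgebra mem_range_map_sliceAlgebra ?_
  obtain ⟨Q, rfl⟩ := hL.1
  refine sliceAlgebra_le (fun p => ?_) fun p => ?_
  · change sliceLeft p (L.inclTensor Q) ∈ _
    rw [L.sliceLeft_inclTensor]
    exact Subtype.property _
  · change sliceRight p (L.inclTensor Q) ∈ _
    rw [L.sliceRight_inclTensor]
    exact Subtype.property _

/-- Characters of a minimal quasitriangular Hopf algebra are determined by their slices of `R`. -/
theorem IsMinimalQuasitriangular.algHom_ext {L : SubHopfAlgebra k H}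
    {Q : L.toSubalgebra ⊗[k] L.toSubalgebra} (hR : IsQuasitriangular (L.inclTensor Q))
    (hL : IsMinimalQuasitriangular (L.inclTensor Q) L) {α β : L.toSubalgebra →ₐ[k] k}
    (h1 : sliceRight α.toLinearMap Q = sliceRight β.toLinearMap Q)
    (h2 : sliceLeft α.toLinearMap Q = sliceLeft β.toLinearMap Q) : α = β := by
  have h : sliceAlgebra (L.inclTensor Q) ≤ (AlgHom.equalizer α β).map L.toSubalgebra.val := by
    refine sliceAlgebra_le (fun p => ?_) fun p => ?_
    · rw [L.sliceLeft_inclTensor]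
      refine ⟨_, ?_, rfl⟩
      change α.toLinearMap _ = β.toLinearMap _
      -- Evaluating `α` on the slice by `p` is evaluating `p` on the slice by `α`.
      rw [apply_sliceLeft, apply_sliceLeft, h1]
    · rw [L.sliceRight_inclTensor]
      refine ⟨_, ?_, rfl⟩
      change α.toLinearMap _ = β.toLinearMap _
      rw [← apply_sliceLeft, ← apply_sliceLeft, h2]
  rw [hL.eq_sliceAlgebra hR] at h
  refine AlgHom.ext fun x => ?_
  obtain ⟨y, hy, hyx⟩ := h x.2
  rw [← Subtype.val_injective hyx]
  exact hy

end SliceAlgebra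

section Main

variable {k H : Type*} [Field k] [Ring H] [HopfAlgebra k H] {L : SubHopfAlgebra k H}
  {Q : L.toSubalgebra ⊗[k] L.toSubalgebra} {l : Module.Dual k H}
  {m : Module.Dual k L.toSubalgebra} {aH : GroupLike k H} {aL : GroupLike k L.toSubalgebra}
  {χH : H ≃ₐ[k] H} {χL : L.toSubalgebra ≃ₐ[k] L.toSubalgebra}


end Main

/-! ### Comparison of the modular data of `L` and `H` -/

section Main

variable {k H : Type*} [Field k] [Ring H] [HopfAlgebra k H] {L : SubHopfAlgebra k H}
  {Q : L.toSubalgebra ⊗[k] L.toSubalgebra} {l : Module.Dual k H}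
  {m : Module.Dual k L.toSubalgebra} {aH : GroupLike k H} {aL : GroupLike k L.toSubalgebra}
  {χH : H ≃ₐ[k] H} {χL : L.toSubalgebra ≃ₐ[k] L.toSubalgebra}

/-- Both sides equal `R¹S(R²)`, computed in `L` and in `H`. -/
theorem IsQuasitriangular.modular_compare (hR : IsQuasitriangular (L.inclTensor Q))
    (hl : l ∈ leftIntegrals k H) (hl0 : l ≠ 0) (hm : m ∈ leftIntegrals k L.toSubalgebra)
    (hm0 : m ≠ 0) (haH : IsModularElement aH) (haL : IsModularElement aL)
    (hχH : IsNakayama χH) (hχL : IsNakayama χL) :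
    (((aL⁻¹).val : L.toSubalgebra) : H) * antipodeMulSwap (L.inclTensor Q) *
        (sliceRight (modularFunctional χL).toLinearMap Q : L.toSubalgebra) =
      (aH⁻¹).val * antipodeMulSwap (L.inclTensor Q) *
        (sliceRight ((modularFunctional χH).comp L.toSubalgebra.val).toLinearMap Q :
          L.toSubalgebra) := by
  have h1 := hR.mulAntipode_eq hl hl0 haH hχH
  have h2 := congrArg Subtype.val ((L.isQuasitriangular hR).mulAntipode_eq hm hm0 haL hχL)
  rw [L.coe_mulAntipode, h1, L.sliceRight_inclTensor] at h2
  rw [← L.coe_antipodeMulSwap]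
  rw [← L.coe_antipodeMulSwap] at h2
  exact h2.symm

theorem GroupLike.isUnit_val (a : GroupLike k H) : IsUnit a.val := a.2.isUnit

theorem SubHopfAlgebra.coe_inv_val_eq_iff :
    (((aL⁻¹).val : L.toSubalgebra) : H) = (aH⁻¹).val ↔ (aL.val : H) = aH.val := by
  have h1 : ∀ (a : GroupLike k L.toSubalgebra) (b : GroupLike k H), (a.val : H) = b.val →
      (((a⁻¹).val : L.toSubalgebra) : H) = (b⁻¹).val := fun a b h => congrArg (antipode k) h
  refine ⟨fun h => ?_, h1 aL aH⟩
  have := h1 _ _ h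
  rwa [inv_inv, inv_inv] at this

theorem IsQuasitriangular.sliceRight_modularFunctional_eq
    (hR : IsQuasitriangular (L.inclTensor Q))
    (hl : l ∈ leftIntegrals k H) (hl0 : l ≠ 0) (hm : m ∈ leftIntegrals k L.toSubalgebra)
    (hm0 : m ≠ 0) (haH : IsModularElement aH) (haL : IsModularElement aL)
    (hχH : IsNakayama χH) (hχL : IsNakayama χL) (h : (aL.val : H) = aH.val) :
    sliceRight (modularFunctional χL).toLinearMap Q =
      sliceRight ((modularFunctional χH).comp L.toSubalgebra.val).toLinearMap Q := by
  have h1 := hR.modular_compare hl hl0 hm hm0 haH haL hχH hχL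
  rw [SubHopfAlgebra.coe_inv_val_eq_iff.mpr h] at h1
  exact Subtype.val_injective
    (((GroupLike.isUnit_val aH⁻¹).mul hR.isUnit_antipodeMulSwap).mul_right_injective h1)

/-- Cancelling `a⁻¹u` in `modular_compare` gives equality of the slices on one leg only; the other
leg comes from `R₂₁⁻¹`. -/
theorem modularFunctional_eq_of_modularElement_eq (hR : IsQuasitriangular (L.inclTensor Q))
    (hL : IsMinimalQuasitriangular (L.inclTensor Q) L)
    (hl : l ∈ leftIntegrals k H) (hl0 : l ≠ 0) (hm : m ∈ leftIntegrals k L.toSubalgebra)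
    (hm0 : m ≠ 0) (haH : IsModularElement aH) (haL : IsModularElement aL)
    (hχH : IsNakayama χH) (hχL : IsNakayama χL) (h : (aL.val : H) = aH.val) :
    modularFunctional χL = (modularFunctional χH).comp L.toSubalgebra.val := by
  have hQ := L.isQuasitriangular hR
  refine hL.algHom_ext hR
    (hR.sliceRight_modularFunctional_eq hl hl0 hm hm0 haH haL hχH hχL h) ?_
  set P := LinearMap.rTensor L.toSubalgebra (antipode k) Q with hP
  -- Integrals, `a` and `χ` do not depend on `R`, so the comparison also applies to `R₂₁⁻¹`. It
  -- equates left slices of `R⁻¹`, and those of `R` are their inverses because slicing by a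
  -- character is multiplicative.
  have hR' : IsQuasitriangular (L.inclTensor (TensorProduct.comm k _ _ P)) := by
    rw [L.inclTensor_comm, hP, L.inclTensor_rTensor_antipode]
    exact hR.comm_inv hR.rTensor_antipode_mul hR.mul_rTensor_antipode
  have h1 := hR'.sliceRight_modularFunctional_eq hl hl0 hm hm0 haH haL hχH hχL h
  rw [← sliceLeft_comm, ← sliceLeft_comm, TensorProduct.comm_comm] at h1
  refine left_inv_eq_right_inv
    (a := sliceLeft (modularFunctional χL).toLinearMap P) ?_ ?_
  · rw [← sliceLeft_mul, hP, hQ.mul_rTensor_antipode, sliceLeft_one]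
  · rw [h1, ← sliceLeft_mul, hP, hQ.rTensor_antipode_mul, sliceLeft_one]

theorem modularElement_eq_of_modularFunctional_eq (hR : IsQuasitriangular (L.inclTensor Q))
    (hl : l ∈ leftIntegrals k H) (hl0 : l ≠ 0) (hm : m ∈ leftIntegrals k L.toSubalgebra)
    (hm0 : m ≠ 0) (haH : IsModularElement aH) (haL : IsModularElement aL)
    (hχH : IsNakayama χH) (hχL : IsNakayama χL)
    (h : modularFunctional χL = (modularFunctional χH).comp L.toSubalgebra.val) :
    (aL.val : H) = aH.val := by
  have hQ := L.isQuasitriangular hR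
  have h1 := hR.modular_compare hl hl0 hm hm0 haH haL hχH hχL
  rw [h] at h1
  set α := (modularFunctional χH).comp L.toSubalgebra.val
  have hu : IsUnit (sliceRight α.toLinearMap Q) := by
    refine ⟨⟨_, sliceRight α.toLinearMap (LinearMap.rTensor _ (antipode k) Q), ?_, ?_⟩, rfl⟩
    · rw [← sliceRight_mul, hQ.mul_rTensor_antipode, sliceRight_one]
    · rw [← sliceRight_mul, hQ.rTensor_antipode_mul, sliceRight_one]
  have h2 := (hu.map L.toSubalgebra.val).mul_left_injective h1
  exact SubHopfAlgebra.coe_inv_val_eq_iff.mp (hR.isUnit_antipodeMulSwap.mul_left_injective h2)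

/-- `S²(χ(x)) = x₁α(x₂)` holds in both algebras, and `S` is injective. -/
theorem nakayama_eq_of_modularFunctional_eq
    (hS : Function.Bijective (antipode k : H →ₗ[k] H))
    (hSL : Function.Bijective (antipode k : L.toSubalgebra →ₗ[k] L.toSubalgebra))
    (hl : l ∈ leftIntegrals k H) (hl0 : l ≠ 0) (hm : m ∈ leftIntegrals k L.toSubalgebra)
    (hm0 : m ≠ 0) (hχH : IsNakayama χH) (hχL : IsNakayama χL)
    (h : modularFunctional χL = (modularFunctional χH).comp L.toSubalgebra.val)
    (x : L.toSubalgebra) : (χL x : H) = χH x := by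
  have h1 := congrArg Subtype.val (hχL.antipode_antipode_apply hSL hm hm0 x)
  rw [h] at h1
  have h2 := hχH.antipode_antipode_apply hS hl hl0 (x : H)
  rw [← L.coe_hit] at h2
  exact hS.1 (hS.1 (h1.trans h2.symm))

end Main

end

theorem mainTheorem5 {k : Type*} {H : Type*} [Field k] [Ring H] [HopfAlgebra k H]
    (hH : IsCoFrobenius k H) (R : H ⊗[k] H) (hR : IsQuasitriangular R)
    (L : SubHopfAlgebra k H) (hL : IsMinimalQuasitriangular R L) :
    IsCoFrobenius k L.toSubalgebra ∧
    (∃! a : GroupLike k H, IsModularElement a) ∧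
    (∃! a : GroupLike k L.toSubalgebra, IsModularElement a) ∧
    (∃! χ : H ≃ₐ[k] H, IsNakayama χ) ∧
    (∃! χ : L.toSubalgebra ≃ₐ[k] L.toSubalgebra, IsNakayama χ) ∧
    ∀ (aH : GroupLike k H) (aL : GroupLike k L.toSubalgebra)
      (χH : H ≃ₐ[k] H) (χL : L.toSubalgebra ≃ₐ[k] L.toSubalgebra),
      IsModularElement aH → IsModularElement aL → IsNakayama χH → IsNakayama χL →
      List.TFAE [
        (aL.val : H) = aH.val,
        modularFunctional χL = (modularFunctional χH).comp L.toSubalgebra.val,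
        ∀ x : L.toSubalgebra, (χL x : H) = χH x] := by
  obtain ⟨Q, rfl⟩ := hL.1
  replace hR : IsQuasitriangular (L.inclTensor Q) := hR
  have hS := hR.bijective_antipode
  have hSL := (L.isQuasitriangular hR).bijective_antipode
  have hcL := L.isCoFrobenius hSL hH
  obtain ⟨l, hl, hl0⟩ := Submodule.exists_mem_ne_zero_of_ne_bot hH
  obtain ⟨m, hm, hm0⟩ := Submodule.exists_mem_ne_zero_of_ne_bot hcL
  refine ⟨hcL, existsUnique_isModularElement hS hl hl0, existsUnique_isModularElement hSL hm hm0,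
    existsUnique_isNakayama hS hl hl0, existsUnique_isNakayama hSL hm hm0, ?_⟩
  intro aH aL χH χL haH haL hχH hχL
  tfae_have 1 → 2 :=
    modularFunctional_eq_of_modularElement_eq hR hL hl hl0 hm hm0 haH haL hχH hχL
  tfae_have 2 → 1 :=
    modularElement_eq_of_modularFunctional_eq hR hl hl0 hm hm0 haH haL hχH hχL
  tfae_have 2 → 3 :=
    nakayama_eq_of_modularFunctional_eq hS hSL hl hl0 hm hm0 hχH hχL
  tfae_have 3 → 2 := fun h => AlgHom.ext fun x => congrArg (Coalgebra.counit (R := k)) (h x)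
  tfae_finish
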